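/- Notation: $d\in\mathbb N=\{1,2,\dots\}$; the Fourier transform is normalized by $\widehat f(\xi)=\mathcal F f(\xi)=\int_{\mathbb R^d}e^{-2\pi i\xi\cdot t}f(t)\,dt$ and extended to vector-valued tempered distributions. A complex Banach space $X$ has Fourier type $p\in[1,2]$ if $\mathcal F$ is bounded from $L^p(\mathbb R^n;X)$ to $L^{p'}(\mathbb R^n;X)$ for some $n\in\mathbb N$, where $\frac1p+\frac1{p'}=1$; it has Fourier cotype $q\in[2,\infty]$ if it has Fourier type $q'$. For $1\le r<\infty$, $L^{r,\infty}(\mathbb R^d)$ is the space of measurable $h$ with $\|h\|_{L^{r,\infty}}=\sup_{t>0}t\,|\{|h|>t\}|^{1/r}<\infty$. A map $m:\mathbb R^d\to\mathcal L(X,Y)$ is $X$-strongly measurable if $\xi\mapsto m(\xi)x$ is strongly measurable for every $x\in X$, and of moderate growth at infinity if there are $\alpha>0$ and $g\in L^1(\mathbb R^d)$ with $(1+|\xi|)^{-\alpha}\|m(\xi)\|\le g(\xi)$ for all $\xi$; for such $m$ one defines $T_m:\mathcal S(\mathbb R^d;X)\to\mathcal S'(\mathbb R^d;Y)$ by $T_mf=\mathcal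 F^{-1}(m\widehat f\,)$. Theorem. Let $d\in\mathbb N$, let $X$ be a complex Banach space with Fourier type $p_0\in(1,2]$ and $Y$ a complex Banach space with Fourier cotype $q_0\in[2,\infty)$, and let $p\in(1,p_0)$ and $q\in(q_0,\infty)$. Let $r\in[1,\infty]$ be such that $\frac1r=\frac1p-\frac1q$ (so that $1<r<\infty$). Then there is a constant $C\ge0$ such that for every $X$-strongly measurable $m:\mathbb R^d\to\mathcal L(X,Y)$ with $[\xi\mapsto\|m(\xi)\|_{\mathcal L(X,Y)}]\in L^{r,\infty}(\mathbb R^d)$ the following holds: $m$ is of moderate growth at infinity, and $T_m$ extends uniquely to a bounded operator from $L^p(\mathbb R^d;X)$ into $L^q(\mathbb R^d;Y)$, with $$\|T_m\|_{\mathcal L(L^p(\mathbb R^d;X),L^q(\mathbb R^d;Y))}\le C\,\big\|\|m(\cdot)\|_{\mathcal L(X,Y)}\big\|_{L^{r,\infty}(\mathbb R^d)}.$$ -/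

import Mathlib

open MeasureTheory FourierTransform SchwartzMap
open scoped ENNReal NNReal

/-- A complex Banach space `X` has Fourier type `p ∈ [1, 2]` if, for some `d ≥ 1`, the Fourier
transform (of tempered distributions, normalized as `∫ e^{-2πi ξ·t} f(t) dt`) maps `L^p(ℝ^d; X)`
boundedly into `L^{p'}(ℝ^d; X)`, where `p'` is the Hölder conjugate of `p`. -/
def HasFourierType (X : Type*) [NormedAddCommGroup X] [NormedSpace ℂ X] [CompleteSpace X]
    (p : ℝ≥0∞) : Prop :=
  p ≤ 2 ∧ ∃ d : ℕ, 1 ≤ d ∧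
    ∃ (p' : ℝ≥0∞) (_ : Fact (1 ≤ p)) (_ : Fact (1 ≤ p')), ENNReal.HolderConjugate p p' ∧
      ∃ F : Lp X p (volume : Measure (EuclideanSpace ℝ (Fin d))) →L[ℂ]
          Lp X p' (volume : Measure (EuclideanSpace ℝ (Fin d))),
        ∀ f, Lp.toTemperedDistribution (F f) = 𝓕 (Lp.toTemperedDistribution f)

/-- `X` has Fourier cotype `q ∈ [2, ∞]` if it has Fourier type `q'`, the Hölder conjugate. -/
def HasFourierCotype (X : Type*) [NormedAddCommGroup X] [NormedSpace ℂ X] [CompleteSpace X]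
    (q : ℝ≥0∞) : Prop :=
  ∃ q' : ℝ≥0∞, ENNReal.HolderConjugate q q' ∧ HasFourierType X q'

/-- The weak `L^p` quasi-norm `sup_{t > 0} t * μ {‖f‖ > t} ^ (1 / p)` for `1 ≤ p < ∞`, with the
usual convention `L^{∞,∞} = L^∞`. -/
noncomputable def weakLpNorm {α E : Type*} [MeasurableSpace α] [NormedAddCommGroup E]
    (f : α → E) (p : ℝ≥0∞) (μ : Measure α) : ℝ≥0∞ :=
  if p = ∞ then eLpNorm f ∞ μ
  else ⨆ (t : ℝ≥0) (_ : 0 < t), (t : ℝ≥0∞) * μ {x | (t : ℝ) < ‖f x‖} ^ (1 / p.toReal)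

/-- Membership in the weak `L^p` space `L^{p,∞}(μ; E)`. -/
def MemWeakLp {α E : Type*} [MeasurableSpace α] [NormedAddCommGroup E]
    (f : α → E) (p : ℝ≥0∞) (μ : Measure α) : Prop :=
  AEStronglyMeasurable f μ ∧ weakLpNorm f p μ < ∞

section Multiplier

variable {X Y : Type*} [NormedAddCommGroup X] [NormedSpace ℂ X]
  [NormedAddCommGroup Y] [NormedSpace ℂ Y] {d : ℕ}

/-- `m : ℝ^d → L(X, Y)` is `X`-strongly measurable: every orbit `ξ ↦ m(ξ) x` is (a.e.) strongly
measurable. -/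
def XStronglyMeasurable (m : EuclideanSpace ℝ (Fin d) → X →L[ℂ] Y) : Prop :=
  ∀ x : X, AEStronglyMeasurable (fun ξ => m ξ x) volume

/-- `m` is of moderate growth at infinity: `(1 + |ξ|)^{-a} ‖m(ξ)‖ ≤ g(ξ)` for some `a > 0` and
some integrable `g`. -/
def HasModerateGrowth (m : EuclideanSpace ℝ (Fin d) → X →L[ℂ] Y) : Prop :=
  ∃ a : ℝ, 0 < a ∧ ∃ g : EuclideanSpace ℝ (Fin d) → ℝ, Integrable g volume ∧
    ∀ ξ, (1 + ‖ξ‖) ^ (-a) * ‖m ξ‖ ≤ g ξ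

theorem XStronglyMeasurable.apply {m : EuclideanSpace ℝ (Fin d) → X →L[ℂ] Y}
    (hm : XStronglyMeasurable m) {f : EuclideanSpace ℝ (Fin d) → X} (hf : StronglyMeasurable f) :
    AEStronglyMeasurable (fun ξ => m ξ (f ξ)) volume := by
  have key : ∀ s : SimpleFunc (EuclideanSpace ℝ (Fin d)) X,
      AEStronglyMeasurable (fun ξ => m ξ (s ξ)) volume := by
    intro s
    induction s using SimpleFunc.induction with
    | const c hs =>
      rename_i S
      refine ((hm c).indicator hs).congr (Filter.Eventually.of_forall fun ξ => ?_)
      by_cases h : ξ ∈ S <;> simp [h]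
    | add hfg h1 h2 =>
      refine (h1.add h2).congr (Filter.Eventually.of_forall fun ξ => ?_)
      simp
  refine aestronglyMeasurable_of_tendsto_ae Filter.atTop (fun n => key (hf.approx n))
    (Filter.Eventually.of_forall fun ξ => ?_)
  exact ((m ξ).continuous.tendsto _).comp (hf.tendsto_approx ξ)

/-- If `m` has moderate growth at infinity, then `m · φ` is integrable for Schwartz `φ`. -/
theorem memLp_one_apply_schwartz {m : EuclideanSpace ℝ (Fin d) → X →L[ℂ] Y}
    (hm : XStronglyMeasurable m) (hg : HasModerateGrowth m)
    (φ : 𝓢(EuclideanSpace ℝ (Fin d), X)) :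
    MemLp (fun ξ => m ξ (φ ξ)) 1 volume := by
  obtain ⟨a, -, g, hgi, hgb⟩ := hg
  rw [memLp_one_iff_integrable]
  obtain ⟨k, hk⟩ := exists_nat_ge a
  set C : ℝ := 2 ^ k * (Finset.Iic (k, 0)).sup (fun i => SchwartzMap.seminorm ℂ i.1 i.2) φ
  refine (hgi.mul_const C).mono' (hm.apply φ.continuous.stronglyMeasurable)
    (Filter.Eventually.of_forall fun ξ => ?_)
  have h1 : (1 + ‖ξ‖) ^ k * ‖φ ξ‖ ≤ C := by
    simpa using one_add_le_sup_seminorm_apply (𝕜 := ℂ) (m := (k, 0)) le_rfl le_rfl φ ξ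
  have hpos : 0 < 1 + ‖ξ‖ := by positivity
  have h2 : (1 + ‖ξ‖) ^ a * ‖φ ξ‖ ≤ C := by
    refine le_trans (mul_le_mul_of_nonneg_right ?_ (norm_nonneg _)) h1
    rw [← Real.rpow_natCast]
    exact Real.rpow_le_rpow_of_exponent_le (by linarith [norm_nonneg ξ]) hk
  have h3 : (1 + ‖ξ‖) ^ (-a) * (1 + ‖ξ‖) ^ a = 1 := by
    rw [← Real.rpow_add hpos]; simp
  calc ‖m ξ (φ ξ)‖ ≤ ‖m ξ‖ * ‖φ ξ‖ := (m ξ).le_opNorm _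
    _ = ((1 + ‖ξ‖) ^ (-a) * ‖m ξ‖) * ((1 + ‖ξ‖) ^ a * ‖φ ξ‖) := by
        rw [mul_mul_mul_comm, h3, one_mul]
    _ ≤ g ξ * C := mul_le_mul (hgb ξ) h2 (by positivity) (le_trans (by positivity) (hgb ξ))

/-- The Fourier multiplier operator `T_m : 𝓢(ℝ^d; X) → 𝓢'(ℝ^d; Y)`, `T_m f = 𝓕⁻¹ (m · 𝓕 f)`, of
an `X`-strongly measurable symbol `m` of moderate growth at infinity. The product `m · 𝓕 f` is an
integrable function, regarded as a tempered distribution. -/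
noncomputable def fourierMultiplierOp [CompleteSpace Y]
    (m : EuclideanSpace ℝ (Fin d) → X →L[ℂ] Y)
    (hm : XStronglyMeasurable m) (hg : HasModerateGrowth m)
    (f : 𝓢(EuclideanSpace ℝ (Fin d), X)) : 𝓢'(EuclideanSpace ℝ (Fin d), Y) :=
  𝓕⁻ (Lp.toTemperedDistribution ((memLp_one_apply_schwartz hm hg (𝓕 f)).toLp
    (fun ξ => m ξ ((𝓕 f) ξ))))

/-- A bounded operator `T : L^p(ℝ^d; X) → L^q(ℝ^d; Y)` extends `T_m`: it agrees with `T_m` on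
`𝓢(ℝ^d; X)`. -/
def ExtendsMultiplierOp [CompleteSpace X] [CompleteSpace Y] {p q : ℝ≥0∞}
    [Fact (1 ≤ p)] [Fact (1 ≤ q)]
    (m : EuclideanSpace ℝ (Fin d) → X →L[ℂ] Y)
    (hm : XStronglyMeasurable m) (hg : HasModerateGrowth m)
    (T : Lp X p (volume : Measure (EuclideanSpace ℝ (Fin d))) →L[ℂ]
      Lp Y q (volume : Measure (EuclideanSpace ℝ (Fin d)))) : Prop :=
  ∀ f : 𝓢(EuclideanSpace ℝ (Fin d), X),
    Lp.toTemperedDistribution (T (f.toLp p volume)) = fourierMultiplierOp m hm hg f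

end Multiplier

/-!
The operator `T_m` is treated as the composition of a Fourier transform, multiplication by the
symbol and an inverse Fourier transform, and each of the three factors is bounded between *weak*
Lebesgue spaces.

Fourier type `p₀` of `X` is the Hausdorff–Young inequality `L^{p₀} → L^{p₀'}` in some dimension. It
passes to dimension one by testing on products and from there to every dimension by estimating the
coordinates one after the other, the mixed norms being exchanged by Minkowski's integral inequality
(`HasFourierType.fourierBound`). Cutting a function at a height and using `L^1 → L^∞` on the large
part and `L^{p₀} → L^{p₀'}` on the small part gives the Fourier transform as a map
`L^{p,∞} → L^{p',∞}` for `1 < p < p₀` (`FourierBound.exists_hasWeakBound`). The same statement for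
`Y`, at the exponent `q'` below the conjugate of `q₀`, gives `L^{q',∞} → L^{q,∞}` for the inverse
Fourier transform. The symbol lies in `L^{r,∞}` and `1 / q' = 1 / p' + 1 / r`, so weak Hölder
(`HasWeakBound.mul`) links the two, and `T_m` is of weak type `(p, q)` for all `p ∈ (1, p₀)` and
`q ∈ (q₀, ∞)` with `1 / p - 1 / q = 1 / r` (`exists_hasWeakBound_multiplier`).

These exponents form an open segment, and `p ≤ q` on it, so off-diagonal Marcinkiewicz interpolation
(`lintegral_rpow_le_of_weakType`) upgrades the weak type to the strong type
(`exists_lintegral_multiplier_le`). Interpolation cuts the argument `f` at heights, hence leaves the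
Schwartz class; it is therefore carried out on all of `L^1` for symbols truncated to be bounded with
bounded support, for which every Fourier integral converges absolutely. The bounds do not depend on
the truncation, and Fatou's lemma removes it for Schwartz functions
(`lintegral_multiplier_le_of_truncation`). Density of the Schwartz functions in `L^p` then gives
the extension and its uniqueness (`exists_unique_extendsMultiplierOp`).
-/

/-! ### Minkowski's integral inequality -/

/-- Minkowski's integral inequality for a minorant `H` of the inner integral whose `L^s` norm is
finite. Hölder's inequality bounds `∫ H ^ s ≤ ∫ H ^ (s - 1) * g` by the right-hand side times a
smaller power of `∫ H ^ s`, and finiteness permits dividing by it. -/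
theorem lintegral_rpow_le_of_le_lintegral {α β : Type*} [MeasurableSpace α] [MeasurableSpace β]
    {μ : Measure α} {ν : Measure β} [SFinite μ] [SFinite ν] {g : α → β → ℝ≥0∞}
    (hg : Measurable (Function.uncurry g)) {s : ℝ} (hs : 1 < s) {H : β → ℝ≥0∞}
    (hH : Measurable H) (hle : ∀ y, H y ≤ ∫⁻ x, g x y ∂μ) (hfin : ∫⁻ y, H y ^ s ∂ν ≠ ∞) :
    ∫⁻ y, H y ^ s ∂ν ≤ (∫⁻ x, (∫⁻ y, g x y ^ s ∂ν) ^ (1 / s) ∂μ) ^ s := by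
  have hs0 : 0 < s := by linarith
  set I := ∫⁻ y, H y ^ s ∂ν with hI
  set R := ∫⁻ x, (∫⁻ y, g x y ^ s ∂ν) ^ (1 / s) ∂μ with hR
  have hc : s.HolderConjugate (s / (s - 1)) := Real.HolderConjugate.conjExponent hs
  have key : I ≤ R * I ^ (1 / (s / (s - 1))) := by
    calc I ≤ ∫⁻ y, ∫⁻ x, g x y * H y ^ (s - 1) ∂μ ∂ν := by
          refine lintegral_mono fun y => ?_
          rw [lintegral_mul_const _ (by fun_prop)]
          calc H y ^ s = H y * H y ^ (s - 1) := by
                conv_lhs => rw [show s = 1 + (s - 1) by ring]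
                rw [ENNReal.rpow_add_of_nonneg _ _ zero_le_one (by linarith), ENNReal.rpow_one]
            _ ≤ _ := by gcongr; exact hle y
      _ = ∫⁻ x, ∫⁻ y, g x y * H y ^ (s - 1) ∂ν ∂μ := by
          rw [lintegral_lintegral_swap]
          refine Measurable.aemeasurable ?_
          exact (hg.comp measurable_swap).mul ((hH.comp measurable_fst).pow_const _)
      _ ≤ ∫⁻ x, (∫⁻ y, g x y ^ s ∂ν) ^ (1 / s) * I ^ (1 / (s / (s - 1))) ∂μ := by
          refine lintegral_mono fun x => ?_
          refine (ENNReal.lintegral_mul_le_Lp_mul_Lq ν hc (f := g x) (g := fun y => H y ^ (s - 1))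
            (by fun_prop) (by fun_prop)).trans_eq ?_
          congr 2
          refine lintegral_congr fun y => ?_
          rw [← ENNReal.rpow_mul]
          congr 1
          have : s - 1 ≠ 0 := by linarith
          field_simp
      _ = R * I ^ (1 / (s / (s - 1))) := by
          rw [lintegral_mul_const]
          refine Measurable.pow_const ?_ _
          exact (hg.pow_const s).lintegral_prod_right'
  rcases eq_or_ne I 0 with h0 | h0
  · rw [h0]; exact zero_le
  have hexp : 1 / (s / (s - 1)) = 1 - 1 / s := by
    have : s - 1 ≠ 0 := by linarith
    field_simp
  rw [hexp] at key
  have h2 : I ^ (1 / s) ≤ R := by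
    have hne : I ^ (1 - 1 / s) ≠ 0 := by
      simp [ENNReal.rpow_eq_zero_iff, h0, hfin]
    have hnt : I ^ (1 - 1 / s) ≠ ∞ := by
      simp [ENNReal.rpow_eq_top_iff, h0, hfin]
    rw [← ENNReal.mul_le_mul_iff_left hne hnt]
    refine le_trans (le_of_eq ?_) key
    rw [← ENNReal.rpow_add _ _ h0 hfin]
    simp
  calc I = (I ^ (1 / s)) ^ s := by
        rw [← ENNReal.rpow_mul, one_div_mul_cancel hs0.ne', ENNReal.rpow_one]
    _ ≤ R ^ s := by gcongr

/-- **Minkowski's integral inequality**: the `L^s` norm of an integral is at most the integral of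
the `L^s` norms. The case of finite left-hand side is Hölder's inequality; the general case follows
by exhausting the inner integral from below. -/
theorem lintegral_rpow_lintegral_le {α β : Type*} [MeasurableSpace α] [MeasurableSpace β]
    {μ : Measure α} {ν : Measure β} [SFinite μ] [SigmaFinite ν] {g : α → β → ℝ≥0∞}
    (hg : Measurable (Function.uncurry g)) {s : ℝ} (hs : 1 ≤ s) :
    ∫⁻ y, (∫⁻ x, g x y ∂μ) ^ s ∂ν ≤ (∫⁻ x, (∫⁻ y, g x y ^ s ∂ν) ^ (1 / s) ∂μ) ^ s := by
  rcases hs.eq_or_lt with rfl | hs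
  · simp only [ENNReal.rpow_one, div_one]
    rw [lintegral_lintegral_swap (f := g) hg.aemeasurable]
  have hs0 : 0 < s := by linarith
  set G : β → ℝ≥0∞ := fun y => ∫⁻ x, g x y ∂μ with hG
  have hGm : Measurable G := hg.lintegral_prod_left'
  -- Truncations of `G` with finite `L^s` norm, increasing to `G`.
  let H : ℕ → β → ℝ≥0∞ := fun n => (spanningSets ν n).indicator (fun y => min (G y) n)
  have hHm : ∀ n, Measurable (H n) := fun n =>
    (hGm.min measurable_const).indicator (measurableSet_spanningSets ν n)
  have hmono : ∀ y, Monotone fun n => H n y := by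
    intro y a b hab
    by_cases hy : y ∈ spanningSets ν a
    · have hy' := monotone_spanningSets ν hab hy
      simp only [H, Set.indicator_of_mem hy, Set.indicator_of_mem hy']
      gcongr
    · simp [H, Set.indicator_of_notMem hy]
  have hlim : ∀ y, ⨆ n, H n y ^ s = G y ^ s := by
    intro y
    refine le_antisymm (iSup_le fun n => ?_) ?_
    · gcongr
      exact Set.indicator_le' (fun _ _ => min_le_left _ _) (fun _ _ => zero_le) y
    · have ht : Filter.Tendsto (fun n : ℕ => min (G y) (n : ℝ≥0∞)) Filter.atTop
          (nhds (min (G y) ∞)) := tendsto_const_nhds.min ENNReal.tendsto_nat_nhds_top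
      have ht2 : Filter.Tendsto (fun n : ℕ => H n y ^ s) Filter.atTop (nhds (G y ^ s)) := by
        rw [min_eq_left le_top] at ht
        refine ((ENNReal.continuous_rpow_const.tendsto _).comp ht).congr' ?_
        have hmem : y ∈ ⋃ i, spanningSets ν i := by rw [iUnion_spanningSets]; trivial
        obtain ⟨N, hN⟩ := Set.mem_iUnion.1 hmem
        filter_upwards [Filter.eventually_ge_atTop N] with n hn
        simp [H, Set.indicator_of_mem (monotone_spanningSets ν hn hN)]
      exact le_of_tendsto' ht2 fun n => le_iSup (fun n => H n y ^ s) n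
  calc ∫⁻ y, G y ^ s ∂ν = ∫⁻ y, ⨆ n, H n y ^ s ∂ν := by simp_rw [hlim]
    _ = ⨆ n, ∫⁻ y, H n y ^ s ∂ν := by
        refine lintegral_iSup (fun n => (hHm n).pow_const s) fun a b hab y => ?_
        have := hmono y hab
        dsimp only at this ⊢
        gcongr
    _ ≤ _ := by
        refine iSup_le fun n => lintegral_rpow_le_of_le_lintegral hg hs (hHm n) (fun y => ?_) ?_
        · exact Set.indicator_le' (fun _ _ => min_le_left _ _) (fun _ _ => zero_le) y
        · refine ne_top_of_le_ne_top (b := (n : ℝ≥0∞) ^ s * ν (spanningSets ν n)) ?_ ?_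
          · exact ENNReal.mul_ne_top (ENNReal.rpow_ne_top_of_nonneg hs0.le (by simp))
              (measure_spanningSets_lt_top ν n).ne
          · rw [← lintegral_indicator_const (measurableSet_spanningSets ν n)]
            refine lintegral_mono fun y => ?_
            by_cases hy : y ∈ spanningSets ν n
            · simp only [H, Set.indicator_of_mem hy]
              gcongr
              exact min_le_right _ _
            · simp [H, Set.indicator_of_notMem hy, hs0]

/-- Minkowski's integral inequality for a kernel `H x * W t` cut off to a set `S`, with the weight
`W` taken out of the power. -/
theorem lintegral_mul_rpow_lintegral_indicator_le {α : Type*} [MeasurableSpace α]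
    {μ : Measure α} [SFinite μ] {ν : Measure ℝ} [SigmaFinite ν] {H : α → ℝ≥0∞} {W : ℝ → ℝ≥0∞}
    (hH : Measurable H) (hW : Measurable W) {S : Set (α × ℝ)} (hS : MeasurableSet S) {s : ℝ}
    (hs : 1 ≤ s) :
    ∫⁻ t, W t * (∫⁻ x, S.indicator (fun z => H z.1) (x, t) ∂μ) ^ s ∂ν ≤
      (∫⁻ x, H x * (∫⁻ t, S.indicator (fun z => W z.2) (x, t) ∂ν) ^ (1 / s) ∂μ) ^ s := by
  have hs0 : 0 < s := by linarith
  have hmeas : Measurable (S.indicator fun z : α × ℝ => H z.1 * W z.2 ^ (1 / s)) :=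
    ((hH.comp measurable_fst).mul ((hW.comp measurable_snd).pow_const _)).indicator hS
  have := lintegral_rpow_lintegral_le (μ := μ) (ν := ν)
    (g := fun x t => S.indicator (fun z => H z.1 * W z.2 ^ (1 / s)) (x, t)) hmeas hs
  refine le_trans (le_of_eq ?_) (this.trans (le_of_eq ?_))
  · refine lintegral_congr fun t => ?_
    have h1 : ∀ x, S.indicator (fun z => H z.1 * W z.2 ^ (1 / s)) (x, t)
        = S.indicator (fun z => H z.1) (x, t) * W t ^ (1 / s) := by
      intro x
      by_cases hx : (x, t) ∈ S <;> simp [hx]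
    have h2 : Measurable fun x => S.indicator (fun z => H z.1) (x, t) :=
      ((hH.comp measurable_fst).indicator hS).comp measurable_prodMk_right
    simp_rw [h1]
    rw [lintegral_mul_const _ h2,
      ENNReal.mul_rpow_of_nonneg _ _ hs0.le, ← ENNReal.rpow_mul, one_div_mul_cancel hs0.ne',
      ENNReal.rpow_one, mul_comm]
  · congr 1
    refine lintegral_congr fun x => ?_
    have h1 : ∀ t, S.indicator (fun z => H z.1 * W z.2 ^ (1 / s)) (x, t) ^ s
        = H x ^ s * S.indicator (fun z => W z.2) (x, t) := by
      intro t
      by_cases hx : (x, t) ∈ S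
      · simp [hx, ENNReal.mul_rpow_of_nonneg _ _ hs0.le, ← ENNReal.rpow_mul, hs0.ne']
      · simp [hx, hs0]
    have h2 : Measurable fun t => S.indicator (fun z => W z.2) (x, t) :=
      ((hW.comp measurable_snd).indicator hS).comp measurable_prodMk_left
    simp_rw [h1]
    rw [lintegral_const_mul _ h2,
      ENNReal.mul_rpow_of_nonneg _ _ (by positivity), ← ENNReal.rpow_mul,
      mul_one_div_cancel hs0.ne', ENNReal.rpow_one]

/-! ### Integrals of powers -/

theorem lintegral_Ioo_rpow_sub_one {θ y : ℝ} (hθ : 0 < θ) (hy : 0 ≤ y) :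
    ∫⁻ t in Set.Ioo 0 y, ENNReal.ofReal (t ^ (θ - 1)) = ENNReal.ofReal (y ^ θ / θ) := by
  have h1 : IntegrableOn (fun t : ℝ => t ^ (θ - 1)) (Set.Ioc 0 y) :=
    (intervalIntegrable_iff_integrableOn_Ioc_of_le hy).1
      (intervalIntegral.intervalIntegrable_rpow' (by linarith))
  rw [restrict_Ioo_eq_restrict_Ioc, ← ofReal_integral_eq_lintegral_ofReal h1,
    ← intervalIntegral.integral_of_le hy, integral_rpow (Or.inl (by linarith))]
  · simp [Real.zero_rpow hθ.ne']
  · filter_upwards [ae_restrict_mem measurableSet_Ioc] with t ht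
    exact Real.rpow_nonneg ht.1.le _

theorem lintegral_Ioi_rpow_neg_sub_one {θ y : ℝ} (hθ : 0 < θ) (hy : 0 < y) :
    ∫⁻ t in Set.Ioi y, ENNReal.ofReal (t ^ (-θ - 1)) = ENNReal.ofReal (y ^ (-θ) / θ) := by
  rw [← ofReal_integral_eq_lintegral_ofReal (integrableOn_Ioi_rpow_of_lt (by linarith) hy),
    integral_Ioi_rpow_of_lt (by linarith) hy]
  · congr 1
    rw [sub_add_cancel, neg_div_neg_eq]
  · filter_upwards [ae_restrict_mem measurableSet_Ioi] with t ht
    exact Real.rpow_nonneg (hy.trans ht).le _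

/-! ### Off-diagonal Marcinkiewicz interpolation -/

/-- The common part of the two halves of Marcinkiewicz interpolation: after Minkowski's integral
inequality it remains to bound, for each `x`, the integral of the weight over the heights `t` at
which the value `h x` is counted. Points with `h x = 0` do not contribute, so the bound is only
needed for `0 < h x`. -/
theorem lintegral_mul_rpow_lintegral_indicator_le_of_inner {α : Type*} [MeasurableSpace α]
    {μ : Measure α} [SFinite μ] {h : α → ℝ} (hh : Measurable h) (h0 : ∀ x, 0 ≤ h x)
    {W : ℝ → ℝ≥0∞} (hW : Measurable W) {S : Set (α × ℝ)} (hS : MeasurableSet S)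
    {p₁ q₁ p e : ℝ} (hp₁ : 0 < p₁) (hpq : p₁ ≤ q₁) (he : p₁ + e * (p₁ / q₁) = p) {K : ℝ≥0∞}
    (hinner : ∀ x, 0 < h x → ∫⁻ t in Set.Ioi 0, S.indicator (fun z => W z.2) (x, t) ≤
      K * ENNReal.ofReal (h x ^ e)) :
    ∫⁻ t in Set.Ioi 0, W t *
        (∫⁻ x, S.indicator (fun z => ENNReal.ofReal (h z.1 ^ p₁)) (x, t) ∂μ) ^ (q₁ / p₁) ≤
      K * (∫⁻ x, ENNReal.ofReal (h x ^ p) ∂μ) ^ (q₁ / p₁) := by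
  have hq₁ : 0 < q₁ := hp₁.trans_le hpq
  have hs : 1 ≤ q₁ / p₁ := (one_le_div hp₁).2 hpq
  refine (lintegral_mul_rpow_lintegral_indicator_le (H := fun x => ENNReal.ofReal (h x ^ p₁))
    (by fun_prop) hW hS hs).trans ?_
  rw [one_div_div]
  calc _ ≤ (∫⁻ x, K ^ (p₁ / q₁) * ENNReal.ofReal (h x ^ p) ∂μ) ^ (q₁ / p₁) := by
        refine ENNReal.rpow_le_rpow (lintegral_mono fun x => ?_) (by positivity)
        rcases (h0 x).eq_or_lt with hx | hx
        · rw [← hx, Real.zero_rpow hp₁.ne', ENNReal.ofReal_zero, zero_mul]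
          exact zero_le
        · calc _ ≤ ENNReal.ofReal (h x ^ p₁) * (K * ENNReal.ofReal (h x ^ e)) ^ (p₁ / q₁) := by
                gcongr
                exact hinner x hx
            _ = _ := by
                rw [ENNReal.mul_rpow_of_nonneg _ _ (by positivity), mul_left_comm,
                  ENNReal.ofReal_rpow_of_nonneg (by positivity) (by positivity),
                  ← ENNReal.ofReal_mul (by positivity), ← Real.rpow_mul hx.le,
                  ← Real.rpow_add hx, he]
    _ = _ := by
        rw [lintegral_const_mul _ (by fun_prop), ENNReal.mul_rpow_of_nonneg _ _ (by positivity),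
          ← ENNReal.rpow_mul, div_mul_div_cancel₀ hq₁.ne', div_self hp₁.ne', ENNReal.rpow_one]

/-- The contribution of the large values of `h` in Marcinkiewicz interpolation. -/
theorem lintegral_rpow_mul_lintegral_lt_le {α : Type*} [MeasurableSpace α]
    {μ : Measure α} [SFinite μ] {h : α → ℝ} (hh : Measurable h) (h0 : ∀ x, 0 ≤ h x)
    {p q p₁ q₁ : ℝ} (hp₁ : 0 < p₁) (hpq : p₁ ≤ q₁) (hp : p₁ < p) (hq : q₁ < q)
    (hline : 1 / p₁ - 1 / q₁ = 1 / p - 1 / q) :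
    ∫⁻ t in Set.Ioi 0, ENNReal.ofReal (t ^ (q - q₁ - 1)) *
        (∫⁻ x, {z : α × ℝ | z.2 ^ (q / p) < h z.1}.indicator
          (fun z => ENNReal.ofReal (h z.1 ^ p₁)) (x, t) ∂μ) ^ (q₁ / p₁) ≤
      ENNReal.ofReal (1 / (q - q₁)) * (∫⁻ x, ENNReal.ofReal (h x ^ p) ∂μ) ^ (q₁ / p₁) := by
  have hp0 : 0 < p := hp₁.trans hp
  have hq₁ : 0 < q₁ := hp₁.trans_le hpq
  have hq0 : 0 < q := hq₁.trans hq
  have hS : MeasurableSet {z : α × ℝ | z.2 ^ (q / p) < h z.1} :=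
    measurableSet_lt (by fun_prop) (by fun_prop)
  refine lintegral_mul_rpow_lintegral_indicator_le_of_inner hh h0
    (W := fun t => ENNReal.ofReal (t ^ (q - q₁ - 1))) (by fun_prop) hS hp₁ hpq
    (e := p / q * (q - q₁)) ?_ fun x hx => ?_
  · field_simp at hline ⊢
    linear_combination -hline
  · have hy : 0 < h x ^ (p / q) := by positivity
    have : ∀ t ∈ Set.Ioi (0 : ℝ), {z : α × ℝ | z.2 ^ (q / p) < h z.1}.indicator
        (fun z => ENNReal.ofReal (z.2 ^ (q - q₁ - 1))) (x, t) =
        (Set.Ioo 0 (h x ^ (p / q))).indicator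
          (fun t => ENNReal.ofReal (t ^ (q - q₁ - 1))) t := by
      intro t ht
      have hiff : t ^ (q / p) < h x ↔ t < h x ^ (p / q) := by
        rw [← inv_div q p, Real.lt_rpow_inv_iff_of_pos (le_of_lt ht) hx.le (by positivity)]
      by_cases hc : t < h x ^ (p / q)
      · rw [Set.indicator_of_mem (by exact hiff.2 hc),
          Set.indicator_of_mem (show t ∈ Set.Ioo _ _ from ⟨ht, hc⟩)]
      · rw [Set.indicator_of_notMem (by exact fun hm => hc (hiff.1 hm)),
          Set.indicator_of_notMem (fun hm => hc hm.2)]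
    rw [setLIntegral_congr_fun measurableSet_Ioi this, lintegral_indicator measurableSet_Ioo,
      Measure.restrict_restrict measurableSet_Ioo,
      Set.inter_eq_left.2 (fun t ht => ht.1), lintegral_Ioo_rpow_sub_one (by linarith) hy.le,
      ← Real.rpow_mul hx.le, ← ENNReal.ofReal_mul (by simp; linarith)]
    apply le_of_eq; congr 1; ring

/-- The contribution of the small values of `h` in Marcinkiewicz interpolation. -/
theorem lintegral_rpow_mul_lintegral_le_le {α : Type*} [MeasurableSpace α]
    {μ : Measure α} [SFinite μ] {h : α → ℝ} (hh : Measurable h) (h0 : ∀ x, 0 ≤ h x)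
    {p q p₂ q₂ : ℝ} (hp0 : 0 < p) (hq0 : 0 < q) (hpq : p₂ ≤ q₂) (hp : p < p₂) (hq : q < q₂)
    (hline : 1 / p₂ - 1 / q₂ = 1 / p - 1 / q) :
    ∫⁻ t in Set.Ioi 0, ENNReal.ofReal (t ^ (q - q₂ - 1)) *
        (∫⁻ x, {z : α × ℝ | h z.1 ≤ z.2 ^ (q / p)}.indicator
          (fun z => ENNReal.ofReal (h z.1 ^ p₂)) (x, t) ∂μ) ^ (q₂ / p₂) ≤
      ENNReal.ofReal (1 / (q₂ - q)) * (∫⁻ x, ENNReal.ofReal (h x ^ p) ∂μ) ^ (q₂ / p₂) := by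
  have hp₂ : 0 < p₂ := hp0.trans hp
  have hq₂ : 0 < q₂ := hq0.trans hq
  have hS : MeasurableSet {z : α × ℝ | h z.1 ≤ z.2 ^ (q / p)} :=
    measurableSet_le (by fun_prop) (by fun_prop)
  refine lintegral_mul_rpow_lintegral_indicator_le_of_inner hh h0
    (W := fun t => ENNReal.ofReal (t ^ (q - q₂ - 1))) (by fun_prop) hS hp₂ hpq
    (e := p / q * (q - q₂)) ?_ fun x hx => ?_
  · field_simp at hline ⊢
    linear_combination -hline
  · have hy : 0 < h x ^ (p / q) := by positivity
    have : ∀ t ∈ Set.Ioi (0 : ℝ), {z : α × ℝ | h z.1 ≤ z.2 ^ (q / p)}.indicator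
        (fun z => ENNReal.ofReal (z.2 ^ (q - q₂ - 1))) (x, t) =
        (Set.Ici (h x ^ (p / q))).indicator
          (fun t => ENNReal.ofReal (t ^ (q - q₂ - 1))) t := by
      intro t ht
      have hiff : h x ≤ t ^ (q / p) ↔ h x ^ (p / q) ≤ t := by
        rw [← inv_div q p, Real.rpow_inv_le_iff_of_pos hx.le (le_of_lt ht) (by positivity)]
      by_cases hc : h x ^ (p / q) ≤ t
      · rw [Set.indicator_of_mem (by exact hiff.2 hc),
          Set.indicator_of_mem (show t ∈ Set.Ici _ from hc)]
      · rw [Set.indicator_of_notMem (by exact fun hm => hc (hiff.1 hm)),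
          Set.indicator_of_notMem (show t ∉ Set.Ici _ from hc)]
    rw [setLIntegral_congr_fun measurableSet_Ioi this, lintegral_indicator measurableSet_Ici,
      Measure.restrict_restrict measurableSet_Ici,
      Set.inter_eq_left.2 (Set.Ici_subset_Ioi.2 hy), setLIntegral_congr Ioi_ae_eq_Ici.symm,
      show q - q₂ - 1 = -(q₂ - q) - 1 by ring, lintegral_Ioi_rpow_neg_sub_one (by linarith) hy,
      ← Real.rpow_mul hx.le, ← ENNReal.ofReal_mul (by simp; linarith)]
    apply le_of_eq; congr 1; rw [neg_sub]; ring

theorem lintegral_indicator_enorm_rpow {α E : Type*} [MeasurableSpace α] [NormedAddCommGroup E]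
    {μ : Measure α} (f : α → E) (S : Set α) {a : ℝ} (ha : 0 < a) :
    ∫⁻ x, ‖S.indicator f x‖ₑ ^ a ∂μ =
      ∫⁻ x, S.indicator (fun x => ENNReal.ofReal (‖f x‖ ^ a)) x ∂μ := by
  refine lintegral_congr fun x => ?_
  by_cases hx : x ∈ S
  · simp only [Set.indicator_of_mem hx]
    rw [← ofReal_norm, ENNReal.ofReal_rpow_of_nonneg (norm_nonneg _) ha.le]
  · simp [Set.indicator_of_notMem hx, ha]

/-- Off-diagonal Marcinkiewicz interpolation for a function normalized in `L^p`: at height `t` the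
function is cut at `‖f‖ = t ^ (q / p)`, and the two weak type bounds are integrated in `t` by means
of Minkowski's integral inequality. -/
theorem lintegral_rpow_le_of_weakType_of_le_one {α β E : Type*} [MeasurableSpace α]
    [MeasurableSpace β] [NormedAddCommGroup E] {μ : Measure α} [SFinite μ] {ν : Measure β}
    {p q p₁ q₁ p₂ q₂ : ℝ} (hp₁ : 0 < p₁) (hpq₁ : p₁ ≤ q₁) (hpq₂ : p₂ ≤ q₂)
    (h1p : p₁ < p) (hp2 : p < p₂) (h1q : q₁ < q) (hq2 : q < q₂)
    (hline₁ : 1 / p₁ - 1 / q₁ = 1 / p - 1 / q) (hline₂ : 1 / p₂ - 1 / q₂ = 1 / p - 1 / q)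
    {T : (α → E) → β → ℝ} (hT0 : ∀ f x, 0 ≤ T f x)
    (hsub : ∀ f g, Integrable f μ → Integrable g μ → ∀ x, T (f + g) x ≤ T f x + T g x)
    (hw₁ : ∀ f, Integrable f μ → ∀ t : ℝ, 0 < t → ν {x | t < T f x} ≤
      ENNReal.ofReal (t ^ (-q₁)) * (∫⁻ x, ‖f x‖ₑ ^ p₁ ∂μ) ^ (q₁ / p₁))
    (hw₂ : ∀ f, Integrable f μ → ∀ t : ℝ, 0 < t → ν {x | t < T f x} ≤
      ENNReal.ofReal (t ^ (-q₂)) * (∫⁻ x, ‖f x‖ₑ ^ p₂ ∂μ) ^ (q₂ / p₂))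
    {f : α → E} (hf : Integrable f μ) (hfm : StronglyMeasurable f) (hTm : AEMeasurable (T f) ν)
    (hf1 : ∫⁻ x, ‖f x‖ₑ ^ p ∂μ ≤ 1) :
    ∫⁻ x, ENNReal.ofReal (T f x ^ q) ∂ν ≤
      ENNReal.ofReal (q * (2 ^ q₁ / (q - q₁) + 2 ^ q₂ / (q₂ - q))) := by
  have hp0 : 0 < p := hp₁.trans h1p
  have hp₂ : 0 < p₂ := hp0.trans hp2
  have hq₁ : 0 < q₁ := hp₁.trans_le hpq₁
  have hq0 : 0 < q := hq₁.trans h1q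
  have hq₂ : 0 < q₂ := hq0.trans hq2
  have hhm : Measurable fun x => ‖f x‖ := hfm.norm.measurable
  have hhm₂ : Measurable fun z : α × ℝ => ‖f z.1‖ := hhm.comp measurable_fst
  have hf1' : ∫⁻ x, ENNReal.ofReal (‖f x‖ ^ p) ∂μ ≤ 1 := by
    refine le_trans (le_of_eq (lintegral_congr fun x => ?_)) hf1
    rw [← ofReal_norm, ENNReal.ofReal_rpow_of_nonneg (norm_nonneg _) hp0.le]
  set S₁ : Set (α × ℝ) := {z | z.2 ^ (q / p) < ‖f z.1‖} with hS₁
  set S₂ : Set (α × ℝ) := {z | ‖f z.1‖ ≤ z.2 ^ (q / p)} with hS₂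
  have hS₁m : MeasurableSet S₁ := measurableSet_lt (by fun_prop) hhm₂
  have hS₂m : MeasurableSet S₂ := measurableSet_le hhm₂ (by fun_prop)
  set J₁ : ℝ → ℝ≥0∞ := fun t =>
    (∫⁻ x, S₁.indicator (fun z => ENNReal.ofReal (‖f z.1‖ ^ p₁)) (x, t) ∂μ) ^ (q₁ / p₁) with hJ₁
  set J₂ : ℝ → ℝ≥0∞ := fun t =>
    (∫⁻ x, S₂.indicator (fun z => ENNReal.ofReal (‖f z.1‖ ^ p₂)) (x, t) ∂μ) ^ (q₂ / p₂) with hJ₂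
  have hJ₁m : Measurable J₁ := by
    refine Measurable.pow_const ?_ _
    refine Measurable.lintegral_prod_left' (μ := μ) (f := S₁.indicator _) ?_
    exact Measurable.indicator (hhm₂.pow_const p₁).ennreal_ofReal hS₁m
  have hb₁ := lintegral_rpow_mul_lintegral_lt_le (μ := μ) hhm (fun x => norm_nonneg _) hp₁ hpq₁
    h1p h1q hline₁
  have hb₂ := lintegral_rpow_mul_lintegral_le_le (μ := μ) hhm (fun x => norm_nonneg _) hp0 hq0
    hpq₂ hp2 hq2 hline₂
  have hpt : ∀ t ∈ Set.Ioi (0 : ℝ), ν {x | t < T f x} * ENNReal.ofReal (t ^ (q - 1)) ≤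
      ENNReal.ofReal (2 ^ q₁) * (ENNReal.ofReal (t ^ (q - q₁ - 1)) * J₁ t) +
      ENNReal.ofReal (2 ^ q₂) * (ENNReal.ofReal (t ^ (q - q₂ - 1)) * J₂ t) := by
    intro t ht
    have ht0 : 0 < t := ht
    set A : Set α := {x | t ^ (q / p) < ‖f x‖} with hA
    have hAm : MeasurableSet A := measurableSet_lt measurable_const hhm
    have hsplit : f = A.indicator f + Aᶜ.indicator f := (Set.indicator_self_add_compl A f).symm
    have hsubset : {x | t < T f x} ⊆
        {x | t / 2 < T (A.indicator f) x} ∪ {x | t / 2 < T (Aᶜ.indicator f) x} := by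
      intro x hx
      by_contra hcon
      simp only [Set.mem_union, Set.mem_ofPred_eq, not_or, not_lt] at hcon hx
      have := hsub _ _ (hf.indicator hAm) (hf.indicator hAm.compl) x
      rw [← hsplit] at this
      linarith [hcon.1, hcon.2]
    have e₁ : (∫⁻ x, ‖A.indicator f x‖ₑ ^ p₁ ∂μ) ^ (q₁ / p₁) = J₁ t := by
      rw [lintegral_indicator_enorm_rpow f A hp₁]; rfl
    have e₂ : (∫⁻ x, ‖Aᶜ.indicator f x‖ₑ ^ p₂ ∂μ) ^ (q₂ / p₂) = J₂ t := by
      rw [lintegral_indicator_enorm_rpow f Aᶜ hp₂, hJ₂]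
      have : Aᶜ = (fun x => (x, t)) ⁻¹' S₂ := by ext x; simp [hA, hS₂]
      rw [this]; rfl
    have hexp : ∀ s : ℝ, ENNReal.ofReal ((t / 2) ^ (-s)) * ENNReal.ofReal (t ^ (q - 1)) =
        ENNReal.ofReal (2 ^ s) * ENNReal.ofReal (t ^ (q - s - 1)) := by
      intro s
      rw [← ENNReal.ofReal_mul (by positivity), ← ENNReal.ofReal_mul (by positivity),
        Real.div_rpow ht0.le (by norm_num), Real.rpow_neg (by norm_num : (0 : ℝ) ≤ 2),
        div_inv_eq_mul, mul_comm (t ^ (-s)), mul_assoc, ← Real.rpow_add ht0]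
      congr 3; ring
    calc _ ≤ (ENNReal.ofReal ((t / 2) ^ (-q₁)) * J₁ t + ENNReal.ofReal ((t / 2) ^ (-q₂)) * J₂ t)
            * ENNReal.ofReal (t ^ (q - 1)) := by
          gcongr
          refine (measure_mono hsubset).trans ((measure_union_le _ _).trans ?_)
          refine add_le_add ?_ ?_
          · rw [← e₁]; exact hw₁ _ (hf.indicator hAm) _ (by positivity)
          · rw [← e₂]; exact hw₂ _ (hf.indicator hAm.compl) _ (by positivity)
      _ = _ := by
          rw [add_mul, mul_right_comm, hexp, mul_right_comm _ (J₂ t), hexp, mul_assoc, mul_assoc]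
  rw [lintegral_rpow_eq_lintegral_meas_lt_mul ν (Filter.Eventually.of_forall (hT0 f)) hTm hq0]
  rw [ENNReal.ofReal_mul hq0.le]
  gcongr
  refine (setLIntegral_mono' measurableSet_Ioi hpt).trans ?_
  rw [lintegral_add_left (by fun_prop), lintegral_const_mul' _ _ ENNReal.ofReal_ne_top,
    lintegral_const_mul' _ _ ENNReal.ofReal_ne_top,
    ENNReal.ofReal_add (div_nonneg (by positivity) (by linarith))
      (div_nonneg (by positivity) (by linarith))]
  have hone : ∀ s : ℝ, 0 ≤ s → (∫⁻ x, ENNReal.ofReal (‖f x‖ ^ p) ∂μ) ^ s ≤ 1 := fun s hs =>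
    ENNReal.rpow_le_one hf1' hs
  refine add_le_add ?_ ?_
  · rw [div_eq_mul_one_div, ENNReal.ofReal_mul (by positivity)]
    gcongr
    refine hb₁.trans ?_
    exact mul_le_of_le_one_right' (hone _ (by positivity))
  · rw [div_eq_mul_one_div, ENNReal.ofReal_mul (by positivity)]
    gcongr
    refine hb₂.trans ?_
    exact mul_le_of_le_one_right' (hone _ (by positivity))

/-- **Off-diagonal Marcinkiewicz interpolation**: a subadditive operator of weak types `(p₁, q₁)`
and `(p₂, q₂)` is of strong type `(p, q)`, for exponents on a line `1 / p - 1 / q = const`. -/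
theorem lintegral_rpow_le_of_weakType {α β E : Type*} [MeasurableSpace α]
    [MeasurableSpace β] [NormedAddCommGroup E] [NormedSpace ℝ E]
    {μ : Measure α} [SFinite μ] {ν : Measure β}
    {p q p₁ q₁ p₂ q₂ : ℝ} (hp₁ : 0 < p₁) (hpq₁ : p₁ ≤ q₁) (hpq₂ : p₂ ≤ q₂)
    (h1p : p₁ < p) (hp2 : p < p₂) (h1q : q₁ < q) (hq2 : q < q₂)
    (hline₁ : 1 / p₁ - 1 / q₁ = 1 / p - 1 / q) (hline₂ : 1 / p₂ - 1 / q₂ = 1 / p - 1 / q)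
    {T : (α → E) → β → ℝ} (hT0 : ∀ f x, 0 ≤ T f x)
    (hsub : ∀ f g, Integrable f μ → Integrable g μ → ∀ x, T (f + g) x ≤ T f x + T g x)
    {D : ℝ} (hD : 0 < D)
    (hw₁ : ∀ f, Integrable f μ → ∀ t : ℝ, 0 < t → ν {x | t < T f x} ≤
      ENNReal.ofReal ((D / t) ^ q₁) * (∫⁻ x, ‖f x‖ₑ ^ p₁ ∂μ) ^ (q₁ / p₁))
    (hw₂ : ∀ f, Integrable f μ → ∀ t : ℝ, 0 < t → ν {x | t < T f x} ≤
      ENNReal.ofReal ((D / t) ^ q₂) * (∫⁻ x, ‖f x‖ₑ ^ p₂ ∂μ) ^ (q₂ / p₂))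
    {f : α → E} (hf : Integrable f μ) (hfm : StronglyMeasurable f) (hTm : AEMeasurable (T f) ν)
    {M : ℝ} (hM : 0 < M) (hfM : ∫⁻ x, ‖f x‖ₑ ^ p ∂μ ≤ ENNReal.ofReal (M ^ p)) :
    ∫⁻ x, ENNReal.ofReal (T f x ^ q) ∂ν ≤
      ENNReal.ofReal (q * (2 ^ q₁ / (q - q₁) + 2 ^ q₂ / (q₂ - q)) * (D * M) ^ q) := by
  have hp0 : 0 < p := hp₁.trans h1p
  have hp₂ : 0 < p₂ := hp0.trans hp2
  have hq₁ : 0 < q₁ := hp₁.trans_le hpq₁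
  have hq0 : 0 < q := hq₁.trans h1q
  have hq₂ : 0 < q₂ := hq0.trans hq2
  -- Both sides are rescaled, so that the weak type constants and the `L^p` norm become `1`.
  set T' : (α → E) → β → ℝ := fun g x => T (M • g) x / (D * M) with hT'
  have hscale : ∀ a : ℝ, 0 < a → ∀ g : α → E, ∫⁻ x, ‖(M • g) x‖ₑ ^ a ∂μ =
      ENNReal.ofReal (M ^ a) * ∫⁻ x, ‖g x‖ₑ ^ a ∂μ := by
    intro a ha g
    rw [← lintegral_const_mul' _ _ ENNReal.ofReal_ne_top]
    refine lintegral_congr fun x => ?_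
    rw [Pi.smul_apply, enorm_smul, ENNReal.mul_rpow_of_nonneg _ _ ha.le,
      Real.enorm_eq_ofReal hM.le, ENNReal.ofReal_rpow_of_nonneg hM.le ha.le]
  have hw : ∀ a b : ℝ, 0 < a → 0 < b → (∀ f, Integrable f μ → ∀ t : ℝ, 0 < t →
      ν {x | t < T f x} ≤ ENNReal.ofReal ((D / t) ^ b) * (∫⁻ x, ‖f x‖ₑ ^ a ∂μ) ^ (b / a)) →
      ∀ f, Integrable f μ → ∀ t : ℝ, 0 < t → ν {x | t < T' f x} ≤
        ENNReal.ofReal (t ^ (-b)) * (∫⁻ x, ‖f x‖ₑ ^ a ∂μ) ^ (b / a) := by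
    intro a b ha hb h g hg t ht
    have hset : {x | t < T' g x} = {x | t * (D * M) < T (M • g) x} := by
      ext x
      simp only [hT', Set.mem_ofPred_eq]
      rw [lt_div_iff₀ (by positivity)]
    rw [hset]
    refine (h _ (hg.smul M) _ (by positivity)).trans (le_of_eq ?_)
    rw [hscale a ha, ENNReal.mul_rpow_of_nonneg _ _ (by positivity), ← mul_assoc,
      ENNReal.ofReal_rpow_of_nonneg (by positivity) (by positivity), ← Real.rpow_mul hM.le,
      mul_div_cancel₀ _ ha.ne', ← ENNReal.ofReal_mul (by positivity),
      ← Real.mul_rpow (by positivity) hM.le, Real.rpow_neg ht.le, ← Real.inv_rpow ht.le]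
    congr 4
    field_simp
  have hMf : M • (M⁻¹ • f) = f := smul_inv_smul₀ hM.ne' f
  have hN : ∫⁻ x, ‖(M⁻¹ • f) x‖ₑ ^ p ∂μ ≤ 1 := by
    have h1 := hscale p hp0 (M⁻¹ • f)
    rw [hMf] at h1
    rw [h1] at hfM
    have hpos : ENNReal.ofReal (M ^ p) ≠ 0 := by
      simp only [ne_eq, ENNReal.ofReal_eq_zero, not_le]; positivity
    refine (ENNReal.mul_le_mul_iff_right hpos ENNReal.ofReal_ne_top).1 ?_
    rwa [mul_one]
  have hmain := lintegral_rpow_le_of_weakType_of_le_one (T := T') (ν := ν) hp₁ hpq₁ hpq₂ h1p hp2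
    h1q hq2 hline₁ hline₂ (fun g x => div_nonneg (hT0 _ _) (by positivity))
    (fun g₁ g₂ h₁ h₂ x => by
      simp only [hT', smul_add]
      rw [← add_div]
      gcongr
      exact hsub _ _ (h₁.smul M) (h₂.smul M) x)
    (hw _ _ hp₁ hq₁ hw₁) (hw _ _ hp₂ hq₂ hw₂) (hf.smul M⁻¹) (hfm.const_smul M⁻¹)
    (by simp only [hT', hMf]; exact hTm.div_const _) hN
  have heq : ∀ x, ENNReal.ofReal (T f x ^ q) =
      ENNReal.ofReal ((D * M) ^ q) * ENNReal.ofReal (T' (M⁻¹ • f) x ^ q) := by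
    intro x
    simp only [hT', hMf]
    rw [← ENNReal.ofReal_mul (by positivity),
      ← Real.mul_rpow (by positivity) (div_nonneg (hT0 _ _) (by positivity)),
      mul_div_cancel₀ _ (by positivity)]
  simp_rw [heq]
  rw [lintegral_const_mul' _ _ ENNReal.ofReal_ne_top, mul_comm (q * _),
    ENNReal.ofReal_mul (by positivity)]
  gcongr

/-! ### Weak `L^p` bounds -/

/-- `f` lies in weak `L^p` with quasi-norm at most `B`, written as a bound on the distribution
function of `f`. -/
def HasWeakBound {α E : Type*} [MeasurableSpace α] [NormedAddCommGroup E] (f : α → E) (p B : ℝ)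
    (μ : Measure α) : Prop :=
  ∀ t : ℝ, 0 < t → μ {x | t < ‖f x‖} ≤ ENNReal.ofReal ((B / t) ^ p)

section WeakBound

variable {α E : Type*} [MeasurableSpace α] [NormedAddCommGroup E] {μ : Measure α}

theorem measure_lt_norm_le {f : α → E} (hf : AEStronglyMeasurable f μ) {p : ℝ} (hp : 0 < p)
    {t : ℝ} (ht : 0 < t) :
    μ {x | t < ‖f x‖} ≤ ENNReal.ofReal (t ^ (-p)) * ∫⁻ x, ‖f x‖ₑ ^ p ∂μ := by
  have h1 := mul_meas_ge_le_lintegral₀ (μ := μ) (hf.enorm.pow_const p) (ENNReal.ofReal (t ^ p))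
  have h2 : {x | t < ‖f x‖} ⊆ {x | ENNReal.ofReal (t ^ p) ≤ ‖f x‖ₑ ^ p} := by
    intro x hx
    have hx' : t < ‖f x‖ := hx
    rw [Set.mem_ofPred_eq]
    rw [← ofReal_norm, ENNReal.ofReal_rpow_of_nonneg (norm_nonneg _) hp.le]
    gcongr
  calc μ {x | t < ‖f x‖} = ENNReal.ofReal (t ^ (-p)) * (ENNReal.ofReal (t ^ p) *
        μ {x | t < ‖f x‖}) := by
        rw [← mul_assoc, ← ENNReal.ofReal_mul (by positivity), ← Real.rpow_add ht]
        simp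
    _ ≤ _ := by
        gcongr
        exact le_trans (by gcongr) h1

theorem HasWeakBound.of_lintegral_le {f : α → E} (hf : AEStronglyMeasurable f μ) {p B : ℝ}
    (hp : 0 < p) (hB : 0 ≤ B) (h : ∫⁻ x, ‖f x‖ₑ ^ p ∂μ ≤ ENNReal.ofReal (B ^ p)) :
    HasWeakBound f p B μ := by
  intro t ht
  refine (measure_lt_norm_le hf hp ht).trans ?_
  calc _ ≤ ENNReal.ofReal (t ^ (-p)) * ENNReal.ofReal (B ^ p) := by gcongr
    _ = _ := by
      rw [← ENNReal.ofReal_mul (by positivity), Real.div_rpow hB ht.le, Real.rpow_neg ht.le]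
      congr 1; field_simp

theorem aestronglyMeasurable_indicator_lt {f : α → E} (hf : AEStronglyMeasurable f μ) (s : ℝ) :
    AEStronglyMeasurable ({x | s < ‖f x‖}.indicator f) μ :=
  hf.indicator₀ (nullMeasurableSet_lt aemeasurable_const hf.norm.aemeasurable)

theorem aestronglyMeasurable_indicator_compl_lt {f : α → E} (hf : AEStronglyMeasurable f μ)
    (s : ℝ) : AEStronglyMeasurable ({x | s < ‖f x‖}ᶜ.indicator f) μ :=
  hf.indicator₀ (nullMeasurableSet_lt aemeasurable_const hf.norm.aemeasurable).compl

/-- The part of a weak `L^p` function above a height is integrable, as `p > 1`. -/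
theorem HasWeakBound.lintegral_indicator_lt_le {f : α → E} (hf : AEStronglyMeasurable f μ)
    {p B s : ℝ} (hw : HasWeakBound f p B μ) (hp : 1 < p) (hB : 0 ≤ B) (hs : 0 < s) :
    ∫⁻ x, ‖{x | s < ‖f x‖}.indicator f x‖ₑ ∂μ ≤
      ENNReal.ofReal (p / (p - 1) * (B ^ p * s ^ (1 - p))) := by
  have h1 : ∫⁻ x, ‖{x | s < ‖f x‖}.indicator f x‖ₑ ∂μ =
      ∫⁻ t in Set.Ioi 0, μ {x | t < ‖{x | s < ‖f x‖}.indicator f x‖} := by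
    rw [← lintegral_eq_lintegral_meas_lt μ (Filter.Eventually.of_forall fun x => norm_nonneg _)
      (aestronglyMeasurable_indicator_lt hf s).norm.aemeasurable]
    simp_rw [ofReal_norm]
  -- Below the height `s` the distribution function of the truncation is constant.
  have hsub : ∀ t : ℝ, 0 < t → {x | t < ‖{x | s < ‖f x‖}.indicator f x‖} ⊆
      {x | max s t < ‖f x‖} := by
    intro t ht x hx
    by_cases hc : s < ‖f x‖
    · rw [Set.mem_ofPred_eq, Set.indicator_of_mem (by exact hc)] at hx
      exact max_lt hc hx
    · rw [Set.mem_ofPred_eq, Set.indicator_of_notMem (by exact hc), norm_zero] at hx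
      exact absurd hx (not_lt.2 ht.le)
  have hpos : 0 < p - 1 := by linarith
  rw [h1, ← Set.Ioc_union_Ioi_eq_Ioi hs.le]
  refine (lintegral_union_le _ _ _).trans ?_
  have hA : ∫⁻ t in Set.Ioc 0 s, μ {x | t < ‖{x | s < ‖f x‖}.indicator f x‖} ≤
      ENNReal.ofReal (B ^ p * s ^ (1 - p)) := by
    calc _ ≤ ∫⁻ t in Set.Ioc 0 s, ENNReal.ofReal ((B / s) ^ p) := by
          refine setLIntegral_mono' measurableSet_Ioc fun t ht => ?_
          refine (measure_mono (hsub t ht.1)).trans ?_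
          rw [max_eq_left ht.2]
          exact hw s hs
      _ = _ := by
          rw [setLIntegral_const, Real.volume_Ioc, ← ENNReal.ofReal_mul (by positivity), sub_zero,
            Real.div_rpow hB hs.le, Real.rpow_sub hs, Real.rpow_one]
          congr 1; field_simp
  have hC : ∫⁻ t in Set.Ioi s, μ {x | t < ‖{x | s < ‖f x‖}.indicator f x‖} ≤
      ENNReal.ofReal (B ^ p * (s ^ (1 - p) / (p - 1))) := by
    calc _ ≤ ∫⁻ t in Set.Ioi s, ENNReal.ofReal (B ^ p) * ENNReal.ofReal (t ^ (-(p - 1) - 1)) := by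
          refine setLIntegral_mono' measurableSet_Ioi fun t ht => ?_
          have ht0 : 0 < t := hs.trans ht
          refine (measure_mono (hsub t ht0)).trans ?_
          rw [max_eq_right (le_of_lt ht)]
          refine (hw t ht0).trans (le_of_eq ?_)
          rw [← ENNReal.ofReal_mul (by positivity), Real.div_rpow hB ht0.le,
            show -(p - 1) - 1 = -p by ring, Real.rpow_neg ht0.le, div_eq_mul_inv]
      _ = _ := by
          rw [lintegral_const_mul' _ _ ENNReal.ofReal_ne_top,
            lintegral_Ioi_rpow_neg_sub_one hpos hs, ← ENNReal.ofReal_mul (by positivity), neg_sub]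
  refine (add_le_add hA hC).trans (le_of_eq ?_)
  rw [← ENNReal.ofReal_add (by positivity) (by positivity)]
  congr 1; field_simp; ring

/-- The part of a weak `L^p` function below a height lies in `L^a` for `a > p`. -/
theorem HasWeakBound.lintegral_indicator_compl_lt_le {f : α → E} (hf : AEStronglyMeasurable f μ)
    {p a B s : ℝ} (hw : HasWeakBound f p B μ) (hp : 0 < p) (ha : p < a) (hB : 0 ≤ B)
    (hs : 0 < s) :
    ∫⁻ x, ‖{x | s < ‖f x‖}ᶜ.indicator f x‖ₑ ^ a ∂μ ≤
      ENNReal.ofReal (a / (a - p) * (B ^ p * s ^ (a - p))) := by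
  have ha0 : 0 < a := hp.trans ha
  have hpos : 0 < a - p := by linarith
  have h1 : ∫⁻ x, ‖{x | s < ‖f x‖}ᶜ.indicator f x‖ₑ ^ a ∂μ =
      ENNReal.ofReal a * ∫⁻ t in Set.Ioi 0, μ {x | t < ‖{x | s < ‖f x‖}ᶜ.indicator f x‖} *
        ENNReal.ofReal (t ^ (a - 1)) := by
    rw [← lintegral_rpow_eq_lintegral_meas_lt_mul μ
      (Filter.Eventually.of_forall fun x => norm_nonneg _)
      (aestronglyMeasurable_indicator_compl_lt hf s).norm.aemeasurable ha0]
    refine lintegral_congr fun x => ?_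
    rw [← ofReal_norm, ENNReal.ofReal_rpow_of_nonneg (norm_nonneg _) ha0.le]
  have hpt : ∀ t ∈ Set.Ioi (0 : ℝ), μ {x | t < ‖{x | s < ‖f x‖}ᶜ.indicator f x‖} *
      ENNReal.ofReal (t ^ (a - 1)) ≤
      (Set.Ioo 0 s).indicator
        (fun t => ENNReal.ofReal (B ^ p) * ENNReal.ofReal (t ^ (a - p - 1))) t := by
    intro t ht
    have ht0 : 0 < t := ht
    have hnorm : ∀ x, t < ‖{x | s < ‖f x‖}ᶜ.indicator f x‖ → t < ‖f x‖ ∧ ‖f x‖ ≤ s := by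
      intro x hx
      by_cases hc : s < ‖f x‖
      · rw [Set.indicator_of_notMem (by simpa using hc), norm_zero] at hx
        exact absurd hx (not_lt.2 ht0.le)
      · rw [Set.indicator_of_mem (by simpa using hc)] at hx
        exact ⟨hx, not_lt.1 hc⟩
    by_cases hts : t < s
    · rw [Set.indicator_of_mem (show t ∈ Set.Ioo 0 s from ⟨ht0, hts⟩)]
      calc _ ≤ ENNReal.ofReal ((B / t) ^ p) * ENNReal.ofReal (t ^ (a - 1)) := by
            gcongr
            exact (measure_mono fun x hx => (hnorm x hx).1).trans (hw t ht0)
        _ = _ := by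
            rw [← ENNReal.ofReal_mul (by positivity), ← ENNReal.ofReal_mul (by positivity),
              Real.div_rpow hB ht0.le, show a - p - 1 = a - 1 - p by ring, Real.rpow_sub ht0 _ p]
            congr 1; field_simp
    · have : {x | t < ‖{x | s < ‖f x‖}ᶜ.indicator f x‖} = ∅ := by
        refine Set.eq_empty_of_forall_notMem fun x hx => hts ?_
        exact (hnorm x hx).1.trans_le (hnorm x hx).2
      rw [this]; simp
  rw [h1]
  calc _ ≤ ENNReal.ofReal a * (ENNReal.ofReal (B ^ p) * ENNReal.ofReal (s ^ (a - p) / (a - p))) := by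
        gcongr
        refine (setLIntegral_mono' measurableSet_Ioi hpt).trans (le_of_eq ?_)
        rw [lintegral_indicator measurableSet_Ioo, Measure.restrict_restrict measurableSet_Ioo,
          Set.inter_eq_left.2 (fun t ht => ht.1), lintegral_const_mul' _ _ ENNReal.ofReal_ne_top,
          lintegral_Ioo_rpow_sub_one hpos hs.le]
    _ = _ := by
        rw [← ENNReal.ofReal_mul (by positivity), ← ENNReal.ofReal_mul (by positivity)]
        congr 1; field_simp

/-- Hölder's inequality for weak `L^p` bounds. -/
theorem HasWeakBound.mul {F G : Type*} [NormedAddCommGroup F] [NormedAddCommGroup G]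
    {m : α → E} {g : α → F} {w : α → G} (hle : ∀ x, ‖w x‖ ≤ ‖m x‖ * ‖g x‖) {r s u A B : ℝ}
    (hr : 0 < r) (hs : 0 < s) (hu : 0 < u) (hrsu : 1 / u = 1 / r + 1 / s) (hA : 0 < A) (hB : 0 < B)
    (hm : HasWeakBound m r A μ) (hg : HasWeakBound g s B μ) :
    HasWeakBound w u (2 ^ (1 / u) * (A * B)) μ := by
  intro t ht
  -- The height `v` at which `m` is cut makes both terms equal to `ρ ^ u`.
  set ρ : ℝ := A * B / t with hρ
  have hρ0 : 0 < ρ := by positivity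
  set v : ℝ := A / ρ ^ (u / r) with hv
  have hv0 : 0 < v := by positivity
  have hsub : {x | t < ‖w x‖} ⊆ {x | v < ‖m x‖} ∪ {x | t / v < ‖g x‖} := by
    intro x hx
    by_contra hcon
    simp only [Set.mem_union, Set.mem_ofPred_eq, not_or, not_lt] at hcon hx
    have := mul_le_mul hcon.1 hcon.2 (norm_nonneg _) hv0.le
    rw [mul_div_cancel₀ _ hv0.ne'] at this
    linarith [hle x]
  have e₁ : (A / v) ^ r = ρ ^ u := by
    rw [hv, div_div_cancel₀ hA.ne', ← Real.rpow_mul hρ0.le, div_mul_cancel₀ _ hr.ne']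
  have e₂ : (B / (t / v)) ^ s = ρ ^ u := by
    have : B / (t / v) = ρ ^ (u / s) := by
      have h3 : u / s = 1 - u / r := by
        field_simp at hrsu ⊢
        linear_combination -hrsu
      rw [h3, Real.rpow_sub hρ0, Real.rpow_one, hv, hρ]
      field_simp
    rw [this, ← Real.rpow_mul hρ0.le, div_mul_cancel₀ _ hs.ne']
  refine (measure_mono hsub).trans ((measure_union_le _ _).trans ?_)
  refine (add_le_add (hm v hv0) (hg (t / v) (by positivity))).trans (le_of_eq ?_)
  rw [e₁, e₂, ← ENNReal.ofReal_add (by positivity) (by positivity), mul_div_assoc, ← hρ,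
    Real.mul_rpow (by positivity) hρ0.le, ← Real.rpow_mul (by norm_num), one_div_mul_cancel hu.ne',
    Real.rpow_one]
  congr 1; ring

/-- A bound in terms of all `B` with `I ≤ B ^ p` is a bound in terms of `I ^ (1 / p)`. The cases
`I = 0` and `I = ∞` are included, the former as a limit. -/
theorem le_mul_rpow_of_forall_le {v c I : ℝ≥0∞} (hc0 : c ≠ 0) (hc : c ≠ ∞) {p q : ℝ} (hp : 0 < p)
    (hq : 0 < q)
    (h : ∀ B : ℝ, 0 < B → I ≤ ENNReal.ofReal (B ^ p) → v ≤ c * ENNReal.ofReal (B ^ q)) :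
    v ≤ c * I ^ (q / p) := by
  rcases eq_or_ne I ∞ with rfl | hI
  · rw [ENNReal.top_rpow_of_pos (by positivity), ENNReal.mul_top hc0]
    exact le_top
  have hlim : Filter.Tendsto (fun ε : ℝ => c * ENNReal.ofReal ((I.toReal + ε) ^ (q / p)))
      (nhdsWithin 0 (Set.Ioi 0)) (nhds (c * I ^ (q / p))) := by
    have hcont : Continuous fun ε : ℝ => ENNReal.ofReal ((I.toReal + ε) ^ (q / p)) :=
      ENNReal.continuous_ofReal.comp
        ((continuous_const.add continuous_id).rpow_const fun _ => Or.inr (by positivity))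
    have h2 := ENNReal.Tendsto.const_mul (a := c) (hcont.tendsto 0) (Or.inr hc)
    rw [add_zero, ← ENNReal.ofReal_rpow_of_nonneg ENNReal.toReal_nonneg (by positivity),
      ENNReal.ofReal_toReal hI] at h2
    exact h2.mono_left nhdsWithin_le_nhds
  refine ge_of_tendsto hlim ?_
  filter_upwards [self_mem_nhdsWithin] with ε hε
  have hε0 : 0 < ε := hε
  have hpos : 0 < I.toReal + ε := by positivity
  refine (h ((I.toReal + ε) ^ (1 / p)) (by positivity) ?_).trans (le_of_eq ?_)
  · rw [← Real.rpow_mul hpos.le, one_div_mul_cancel hp.ne', Real.rpow_one]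
    conv_lhs => rw [← ENNReal.ofReal_toReal hI]
    gcongr
    linarith
  · rw [← Real.rpow_mul hpos.le, one_div_mul_eq_div]

end WeakBound

/-! ### Fourier integrals of vector-valued integrable functions -/

section FourierIntegral

variable {V X : Type*} [NormedAddCommGroup V] [InnerProductSpace ℝ V] [FiniteDimensional ℝ V]
  [MeasurableSpace V] [BorelSpace V] [NormedAddCommGroup X] [NormedSpace ℂ X]

theorem fourier_add_apply {f g : V → X} (hf : Integrable f) (hg : Integrable g) (ξ : V) :
    𝓕 (f + g) ξ = 𝓕 f ξ + 𝓕 g ξ := by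
  simp only [Real.fourier_eq, Pi.add_apply, smul_add]
  exact integral_add ((Real.fourierIntegral_convergent_iff ξ).2 hf)
    ((Real.fourierIntegral_convergent_iff ξ).2 hg)

theorem fourierInv_add_apply {f g : V → X} (hf : Integrable f) (hg : Integrable g) (ξ : V) :
    𝓕⁻ (f + g) ξ = 𝓕⁻ f ξ + 𝓕⁻ g ξ := by
  simp only [Real.fourierInv_eq_fourier_neg, fourier_add_apply hf hg]

theorem enorm_fourier_le (f : V → X) (ξ : V) : ‖𝓕 f ξ‖ₑ ≤ ∫⁻ x, ‖f x‖ₑ := by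
  rw [Real.fourier_eq]
  refine (enorm_integral_le_lintegral_enorm _).trans (le_of_eq (lintegral_congr fun x => ?_))
  rw [← ofReal_norm, Circle.norm_smul, ofReal_norm]

theorem continuous_fourier {f : V → X} (hf : Integrable f) : Continuous (𝓕 f) :=
  VectorFourier.fourierIntegral_continuous Real.continuous_fourierChar
    (by exact continuous_inner) hf

theorem continuous_fourierInv {f : V → X} (hf : Integrable f) : Continuous (𝓕⁻ f) := by
  have : 𝓕⁻ f = fun ξ => 𝓕 f (-ξ) := funext fun ξ => Real.fourierInv_eq_fourier_neg f ξ
  rw [this]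
  exact (continuous_fourier hf).comp continuous_neg

theorem integral_schwartz_smul_fourier [CompleteSpace X] {f : V → X} (hf : Integrable f)
    (φ : 𝓢(V, ℂ)) : ∫ x, (𝓕 φ) x • f x = ∫ ξ, φ ξ • 𝓕 f ξ := by
  have h := VectorFourier.integral_fourierIntegral_smul_eq_flip (μ := volume) (ν := volume)
    (L := innerₗ V) Real.continuous_fourierChar (by exact continuous_inner)
    (φ.integrable (μ := volume)) hf
  rw [flip_innerₗ] at h
  exact h

theorem integral_schwartz_smul_fourierInv [CompleteSpace X] {f : V → X} (hf : Integrable f)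
    (φ : 𝓢(V, ℂ)) : ∫ x, (𝓕⁻ φ) x • f x = ∫ ξ, φ ξ • 𝓕⁻ f ξ := by
  have h := VectorFourier.integral_fourierIntegral_smul_eq_flip (μ := volume) (ν := volume)
    (L := -innerₗ V) Real.continuous_fourierChar (by exact continuous_inner.neg)
    (φ.integrable (μ := volume)) hf
  have h2 : (-innerₗ V).flip = -innerₗ V := by
    ext x y; simp [real_inner_comm]
  rw [h2] at h
  rw [SchwartzMap.fourierInv_coe]
  exact h

theorem ae_eq_of_integral_schwartz_smul_eq [CompleteSpace X] {u v : V → X}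
    (hu : LocallyIntegrable u) (hv : LocallyIntegrable v)
    (h : ∀ φ : 𝓢(V, ℂ), ∫ x, φ x • u x = ∫ x, φ x • v x) : u =ᵐ[volume] v := by
  refine ae_eq_of_integral_contDiff_smul_eq hu hv fun g g_smooth g_cpt => ?_
  have hg₁ : HasCompactSupport (Complex.ofRealCLM ∘ g) := g_cpt.comp_left rfl
  have hg₂ : ContDiff ℝ ((⊤ : ℕ∞) : WithTop ℕ∞) (Complex.ofRealCLM ∘ g) := by fun_prop
  simpa using h (hg₁.toSchwartzMap hg₂)

/-! ### The Hausdorff–Young inequality on integrable functions -/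

variable (V X) in
/-- The Hausdorff–Young inequality with exponents `a` and `b` for `X`-valued functions on `V`,
stated for Fourier integrals of integrable functions. The constant is nonzero, so that the bound is
void for an integrable function outside of `L^a`, where the right-hand side is infinite. -/
def FourierBound (a b : ℝ) : Prop :=
  ∃ C : ℝ≥0, C ≠ 0 ∧ ∀ f : V → X, Integrable f →
    ∫⁻ ξ, ‖𝓕 f ξ‖ₑ ^ b ≤ C * (∫⁻ x, ‖f x‖ₑ ^ a) ^ (b / a)

theorem FourierBound.of_stronglyMeasurable {a b : ℝ} {C : ℝ≥0}
    (h : ∀ f : V → X, StronglyMeasurable f → Integrable f →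
      ∫⁻ ξ, ‖𝓕 f ξ‖ₑ ^ b ≤ C * (∫⁻ x, ‖f x‖ₑ ^ a) ^ (b / a)) (_hab : 0 ≤ b / a) :
    FourierBound V X a b := by
  -- Replacing `C` by `C + 1` makes the constant nonzero.
  refine ⟨C + 1, by positivity, fun f hf => ?_⟩
  have hae := hf.1.ae_eq_mk
  have h1 := h _ hf.1.stronglyMeasurable_mk (hf.congr hae)
  have h2 : ∫⁻ x, ‖f x‖ₑ ^ a = ∫⁻ x, ‖hf.1.mk f x‖ₑ ^ a :=
    lintegral_congr_ae (by filter_upwards [hae] with x hx; rw [← hx])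
  rw [h2]
  simp_rw [Real.fourier_congr_ae hae]
  refine h1.trans ?_
  gcongr
  simp

/-- A Banach space with Fourier type `p` satisfies the Hausdorff–Young inequality in the dimension
witnessing the Fourier type. -/
theorem HasFourierType.exists_fourierBound [CompleteSpace X] {p p' : ℝ≥0∞} (hX : HasFourierType X p)
    (hp : 1 < p) (hpp : ENNReal.HolderConjugate p p') :
    ∃ n : ℕ, FourierBound (EuclideanSpace ℝ (Fin (n + 1))) X p.toReal p'.toReal := by
  obtain ⟨hp2, d, hd, p'', hp1, hp1', hconj, F, hF⟩ := hX
  obtain rfl : p'' = p' := ENNReal.HolderConjugate.unique p p'' p'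
  obtain ⟨n, rfl⟩ : ∃ n, d = n + 1 := ⟨d - 1, by omega⟩
  have hpt : p ≠ ∞ := (hp2.trans_lt (by simp)).ne
  have hp0 : p ≠ 0 := (zero_lt_one.trans hp).ne'
  have hp't : p'' ≠ ∞ := by
    have := (ENNReal.HolderConjugate.lt_top_iff_one_lt p'' p).2 hp
    exact this.ne
  have hp'0 : p'' ≠ 0 := (zero_lt_one.trans_le hp1'.out).ne'
  have ha : 0 < p.toReal := ENNReal.toReal_pos hp0 hpt
  have hb : 0 < p''.toReal := ENNReal.toReal_pos hp'0 hp't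
  refine ⟨n, (‖F‖₊ + 1) ^ p''.toReal, by positivity, fun f hf => ?_⟩
  by_cases hI : ∫⁻ x, ‖f x‖ₑ ^ p.toReal = ∞
  · rw [hI, ENNReal.top_rpow_of_pos (by positivity), ENNReal.mul_top (by simp)]
    exact le_top
  have hfL : MemLp f p :=
    ⟨hf.1, (eLpNorm_lt_top_iff_lintegral_rpow_enorm_lt_top hp0 hpt).2 (lt_top_iff_ne_top.2 hI)⟩
  set g := F hfL.toLp with hg
  -- `F f` and the Fourier integral of `f` agree as tempered distributions.
  have hae : (g : EuclideanSpace ℝ (Fin (n + 1)) → X) =ᵐ[volume] 𝓕 f := by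
    refine ae_eq_of_integral_schwartz_smul_eq ((Lp.memLp g).locallyIntegrable hp1'.out)
      (continuous_fourier hf).locallyIntegrable fun φ => ?_
    have h1 := congrArg (fun T => T φ) (hF hfL.toLp)
    simp only [TemperedDistribution.fourier_apply, Lp.toTemperedDistribution_apply] at h1
    rw [hg, h1, ← integral_schwartz_smul_fourier hf]
    refine integral_congr_ae ?_
    filter_upwards [hfL.coeFn_toLp] with x hx
    rw [hx]
  have hnorm : eLpNorm (𝓕 f) p'' volume ≤ (‖F‖₊ + 1 : ℝ≥0) * eLpNorm f p volume := by
    rw [← eLpNorm_congr_ae hae, ← Lp.enorm_def, ← eLpNorm_congr_ae hfL.coeFn_toLp, ← Lp.enorm_def]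
    refine (F.le_opENorm _).trans ?_
    gcongr
    rw [enorm_eq_nnnorm]
    gcongr
    simp
  rw [eLpNorm_eq_lintegral_rpow_enorm_toReal hp'0 hp't,
    eLpNorm_eq_lintegral_rpow_enorm_toReal hp0 hpt] at hnorm
  have := ENNReal.rpow_le_rpow hnorm hb.le
  rw [← ENNReal.rpow_mul, one_div_mul_cancel hb.ne', ENNReal.rpow_one,
    ENNReal.mul_rpow_of_nonneg _ _ hb.le, ← ENNReal.rpow_mul, one_div_mul_eq_div] at this
  refine this.trans (le_of_eq ?_)
  rw [ENNReal.coe_rpow_of_nonneg _ hb.le]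

/-- The weak type Hausdorff–Young inequality below the exponent `a`: cutting `f` at a height `s`,
the large part is controlled through `L^1 → L^∞` and the small part through `L^a → L^b`. -/
theorem FourierBound.exists_hasWeakBound {a b p p' : ℝ} (h : FourierBound V X a b)
    (hab : 1 / a + 1 / b = 1) (hpp : 1 / p + 1 / p' = 1) (hp : 1 < p) (hpa : p < a) :
    ∃ K : ℝ, 0 < K ∧ ∀ f : V → X, Integrable f → ∀ B : ℝ, 0 < B →
      HasWeakBound f p B volume → HasWeakBound (𝓕 f) p' (K * B) volume := by
  obtain ⟨C, hC0, hC⟩ := h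
  have hp0 : 0 < p := by linarith
  have ha0 : 0 < a := by linarith
  have hp1 : 0 < p - 1 := by linarith
  have hap : 0 < a - p := by linarith
  have hp' : p' = p / (p - 1) := by
    have : p' ≠ 0 := by rintro rfl; simp at hpp; linarith
    field_simp at hpp ⊢; linarith
  have hb : b = a / (a - 1) := by
    have : b ≠ 0 := by rintro rfl; simp at hab; linarith
    have : a - 1 ≠ 0 := by linarith
    field_simp at hab ⊢; linarith
  have hp'0 : 0 < p' := by rw [hp']; positivity
  have hb0 : 0 < b := by rw [hb]; exact div_pos ha0 (by linarith)
  have hCpos : (0 : ℝ) < C := by positivity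
  set κ : ℝ := 2 * (p / (p - 1)) with hκ
  have hκ0 : 0 < κ := by positivity
  set K₀ : ℝ := 2 ^ b * (C * (a / (a - p) * κ ^ ((a - p) / (p - 1))) ^ (b / a)) with hK₀
  have hK₀0 : 0 < K₀ := by positivity
  refine ⟨K₀ ^ (1 / p'), by positivity, fun f hf B hB hw t ht => ?_⟩
  -- With this height the large part contributes at most `t / 2` to `𝓕 f`.
  set s : ℝ := (κ * (B ^ p / t)) ^ (1 / (p - 1)) with hs
  have hs0 : 0 < s := by positivity
  have hfm := hf.1
  set A : Set V := {x | s < ‖f x‖} with hA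
  have hAm : NullMeasurableSet A := nullMeasurableSet_lt aemeasurable_const hfm.norm.aemeasurable
  have hf₁ : Integrable (A.indicator f) := hf.indicator₀ hAm
  have hf₂ : Integrable (Aᶜ.indicator f) := hf.indicator₀ hAm.compl
  have hbig : ∀ ξ, ‖𝓕 (A.indicator f) ξ‖ ≤ t / 2 := by
    intro ξ
    have h1 := (enorm_fourier_le (A.indicator f) ξ).trans
      (hw.lintegral_indicator_lt_le hfm hp hB.le hs0)
    rw [← ofReal_norm] at h1
    refine ((ENNReal.ofReal_le_ofReal_iff (by positivity)).1 h1).trans (le_of_eq ?_)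
    have : s ^ (1 - p) = (κ * (B ^ p / t))⁻¹ := by
      rw [hs, ← Real.rpow_mul (by positivity), ← Real.rpow_neg_one]
      congr 1; field_simp; ring
    rw [this, hκ]
    field_simp
  have hsub : {ξ | t < ‖𝓕 f ξ‖} ⊆ {ξ | t / 2 < ‖𝓕 (Aᶜ.indicator f) ξ‖} := by
    intro ξ hξ
    rw [Set.mem_ofPred_eq] at hξ ⊢
    rw [← Set.indicator_self_add_compl A f, fourier_add_apply hf₁ hf₂] at hξ
    linarith [norm_add_le (𝓕 (A.indicator f) ξ) (𝓕 (Aᶜ.indicator f) ξ), hbig ξ]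
  calc volume {ξ | t < ‖𝓕 f ξ‖} ≤ volume {ξ | t / 2 < ‖𝓕 (Aᶜ.indicator f) ξ‖} :=
        measure_mono hsub
    _ ≤ ENNReal.ofReal ((t / 2) ^ (-b)) * ∫⁻ ξ, ‖𝓕 (Aᶜ.indicator f) ξ‖ₑ ^ b :=
        measure_lt_norm_le (continuous_fourier hf₂).aestronglyMeasurable hb0 (by positivity)
    _ ≤ ENNReal.ofReal ((t / 2) ^ (-b)) *
          (C * ENNReal.ofReal (a / (a - p) * (B ^ p * s ^ (a - p))) ^ (b / a)) := by
        gcongr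
        refine (hC _ hf₂).trans ?_
        gcongr
        exact hw.lintegral_indicator_compl_lt_le hfm hp0 hpa hB.le hs0
    _ = ENNReal.ofReal ((t / 2) ^ (-b) *
          (C * (a / (a - p) * (B ^ p * s ^ (a - p))) ^ (b / a))) := by
        rw [ENNReal.ofReal_rpow_of_nonneg (by positivity) (by positivity),
          ← ENNReal.ofReal_coe_nnreal, ← ENNReal.ofReal_mul (by positivity),
          ← ENNReal.ofReal_mul (by positivity)]
    _ = ENNReal.ofReal ((K₀ ^ (1 / p') * B / t) ^ p') := by
        congr 1
        have e1 : s ^ (a - p) = κ ^ ((a - p) / (p - 1)) * (B ^ p / t) ^ ((a - p) / (p - 1)) := by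
          rw [hs, ← Real.rpow_mul (by positivity), Real.mul_rpow (by positivity) (by positivity),
            one_div_mul_eq_div]
        have e2 : (t / 2) ^ (-b) = 2 ^ b * t ^ (-b) := by
          rw [Real.div_rpow ht.le (by norm_num), Real.rpow_neg (by norm_num : (0 : ℝ) ≤ 2),
            div_inv_eq_mul, mul_comm]
        have e3 : t ^ (-b) * (B ^ p * (B ^ p / t) ^ ((a - p) / (p - 1))) ^ (b / a) =
            (B / t) ^ p' := by
          obtain ⟨x, rfl⟩ : ∃ x, B = Real.exp x := ⟨Real.log B, (Real.exp_log hB).symm⟩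
          obtain ⟨y, rfl⟩ : ∃ y, t = Real.exp y := ⟨Real.log t, (Real.exp_log ht).symm⟩
          simp only [← Real.exp_sub, ← Real.exp_mul, ← Real.exp_add]
          congr 1
          have : a - 1 ≠ 0 := by linarith
          rw [hp', hb]
          field_simp
          ring
        have e4 : (K₀ ^ (1 / p') * B / t) ^ p' = K₀ * (B / t) ^ p' := by
          rw [mul_div_assoc, Real.mul_rpow (by positivity) (by positivity),
            ← Real.rpow_mul hK₀0.le, one_div_mul_cancel hp'0.ne', Real.rpow_one]
        rw [e4, ← e3, e1, e2, hK₀, mul_left_comm (B ^ p),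
          ← mul_assoc (a / (a - p)), Real.mul_rpow (by positivity) (by positivity)]
        ring

end FourierIntegral

/-! ### Independence of the dimension -/

section Dimension

open scoped RealInnerProductSpace

variable {X : Type*} [NormedAddCommGroup X] [NormedSpace ℂ X]

/-- The splitting `ℝ × ℝ^n ≃ ℝ^(n+1)` of the first coordinate. -/
noncomputable def euclideanConsEquiv (n : ℕ) :
    ℝ × EuclideanSpace ℝ (Fin n) ≃ᵐ EuclideanSpace ℝ (Fin (n + 1)) :=
  ((MeasurableEquiv.refl ℝ).prodCongr (MeasurableEquiv.toLp 2 (Fin n → ℝ)).symm).trans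
    ((MeasurableEquiv.piFinSuccAbove (fun _ => ℝ) 0).symm.trans
      (MeasurableEquiv.toLp 2 (Fin (n + 1) → ℝ)))

theorem euclideanConsEquiv_apply (n : ℕ) (z : ℝ × EuclideanSpace ℝ (Fin n)) :
    euclideanConsEquiv n z = WithLp.toLp 2 (Fin.cons z.1 (WithLp.ofLp z.2) : Fin (n + 1) → ℝ) := by
  ext i
  simp [euclideanConsEquiv, MeasurableEquiv.piFinSuccAbove]
  rfl

theorem measurePreserving_euclideanConsEquiv (n : ℕ) :
    MeasurePreserving (euclideanConsEquiv n) := by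
  have h1 : MeasurePreserving ((MeasurableEquiv.refl ℝ).prodCongr
      (MeasurableEquiv.toLp 2 (Fin n → ℝ)).symm) :=
    (MeasurePreserving.id volume).prod (PiLp.volume_preserving_ofLp (Fin n))
  have h2 := (volume_preserving_piFinSuccAbove (fun _ : Fin (n + 1) => ℝ) 0).symm
  have h3 := PiLp.volume_preserving_toLp (Fin (n + 1))
  exact h3.comp (h2.comp h1)

theorem inner_euclideanConsEquiv (n : ℕ) (z w : ℝ × EuclideanSpace ℝ (Fin n)) :
    ⟪euclideanConsEquiv n z, euclideanConsEquiv n w⟫ = ⟪z.1, w.1⟫ + ⟪z.2, w.2⟫ := by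
  rw [euclideanConsEquiv_apply, euclideanConsEquiv_apply]
  simp [PiLp.inner_apply, Fin.sum_univ_succ]

theorem fourier_euclideanConsEquiv {n : ℕ} (f : EuclideanSpace ℝ (Fin (n + 1)) → X)
    (w : ℝ × EuclideanSpace ℝ (Fin n)) :
    𝓕 f (euclideanConsEquiv n w) =
      ∫ z : ℝ × EuclideanSpace ℝ (Fin n),
        (Real.fourierChar (-⟪z.1, w.1⟫) * Real.fourierChar (-⟪z.2, w.2⟫)) •
          f (euclideanConsEquiv n z) := by
  rw [Real.fourier_eq, ← (measurePreserving_euclideanConsEquiv n).integral_comp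
    (euclideanConsEquiv n).measurableEmbedding]
  refine integral_congr_ae (Filter.Eventually.of_forall fun z => ?_)
  simp only
  rw [inner_euclideanConsEquiv, neg_add, AddChar.map_add_eq_mul]

/-- Hausdorff–Young in dimension `n + 1` implies Hausdorff–Young in dimension one, by testing on
products with a fixed Schwartz function of the other variables. -/
theorem FourierBound.real_of_succ {n : ℕ} {a b : ℝ} (ha : 0 < a) (hb : 0 < b)
    (h : FourierBound (EuclideanSpace ℝ (Fin (n + 1))) X a b) : FourierBound ℝ X a b := by
  obtain ⟨C, hC0, hC⟩ := h
  obtain ⟨φ, hφ⟩ : ∃ φ : 𝓢(EuclideanSpace ℝ (Fin n), ℂ), φ ≠ 0 := by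
    let g : ContDiffBump (0 : EuclideanSpace ℝ (Fin n)) := ⟨1, 2, one_pos, one_lt_two⟩
    have hg₁ : HasCompactSupport (Complex.ofRealCLM ∘ g) := g.hasCompactSupport.comp_left rfl
    have hg₂ : ContDiff ℝ ((⊤ : ℕ∞) : WithTop ℕ∞) (Complex.ofRealCLM ∘ g) :=
      Complex.ofRealCLM.contDiff.comp g.contDiff
    refine ⟨hg₁.toSchwartzMap hg₂, fun h0 => ?_⟩
    have h1 := congrArg (fun ψ : 𝓢(EuclideanSpace ℝ (Fin n), ℂ) => ψ 0) h0
    have h2 : g 0 = 1 := g.one_of_mem_closedBall (Metric.mem_closedBall_self zero_le_one)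
    simp [h2] at h1
  have hfin : ∀ (ψ : 𝓢(EuclideanSpace ℝ (Fin n), ℂ)) (c : ℝ), 0 < c →
      ∫⁻ y, ‖ψ y‖ₑ ^ c < ∞ := fun ψ c hc => by
    have h1 := (ψ.memLp (ENNReal.ofReal c) volume).2
    have h2 := lintegral_rpow_enorm_lt_top_of_eLpNorm_lt_top (p := ENNReal.ofReal c)
      (by simpa using hc) ENNReal.ofReal_ne_top h1
    rwa [ENNReal.toReal_ofReal hc.le] at h2
  set Φ := ∫⁻ y, ‖φ y‖ₑ ^ a with hΦ
  set Ψ := ∫⁻ y, ‖(𝓕 φ) y‖ₑ ^ b with hΨ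
  have hΦt : Φ ≠ ∞ := (hfin φ a ha).ne
  have hΨt : Ψ ≠ ∞ := (hfin (𝓕 φ) b hb).ne
  have hΨ0 : Ψ ≠ 0 := by
    intro h0
    rw [hΨ, lintegral_eq_zero_iff ((𝓕 φ).continuous.enorm.measurable.pow_const b)] at h0
    have hz : ((𝓕 φ : 𝓢(EuclideanSpace ℝ (Fin n), ℂ)) : EuclideanSpace ℝ (Fin n) → ℂ) =
        fun _ => 0 := by
      refine ((𝓕 φ).continuous.ae_eq_iff_eq volume continuous_const).1 ?_
      filter_upwards [h0] with y hy
      simpa [hb] using hy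
    have hz' : 𝓕 φ = 0 := by ext y; exact congrFun hz y
    have h3 : 𝓕⁻ (𝓕 φ) = φ := FourierTransform.fourierInv_fourier_eq φ
    rw [hz'] at h3
    rw [← h3] at hφ
    exact hφ (FourierTransform.fourierInvCLM ℂ 𝓢(EuclideanSpace ℝ (Fin n), ℂ)).map_zero
  refine FourierBound.of_stronglyMeasurable (C := (Ψ⁻¹ * (C * Φ ^ (b / a))).toNNReal)
    (fun g hgm hg => ?_) (by positivity)
  have hconst : Ψ⁻¹ * (C * Φ ^ (b / a)) ≠ ∞ :=
    ENNReal.mul_ne_top (ENNReal.inv_ne_top.2 hΨ0) (ENNReal.mul_ne_top ENNReal.coe_ne_top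
      (ENNReal.rpow_ne_top_of_nonneg (by positivity) hΦt))
  rw [ENNReal.coe_toNNReal hconst]
  set e := euclideanConsEquiv n
  have he : MeasurePreserving e := measurePreserving_euclideanConsEquiv n
  set f : EuclideanSpace ℝ (Fin (n + 1)) → X := fun v => φ (e.symm v).2 • g (e.symm v).1 with hf
  have hfe : ∀ z, f (e z) = φ z.2 • g z.1 := fun z => by simp [hf]
  have hprod : Integrable (fun z : ℝ × EuclideanSpace ℝ (Fin n) => φ z.2 • g z.1) := by
    have := (hg.norm.mul_prod (φ.integrable (μ := volume)).norm)
    refine this.mono' ?_ (Filter.Eventually.of_forall fun z => ?_)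
    · exact ((φ.continuous.comp continuous_snd).stronglyMeasurable.smul
        (hgm.comp_measurable measurable_fst)).aestronglyMeasurable
    · rw [norm_smul, mul_comm]
  have hfi : Integrable f := by
    rw [← he.integrable_comp_emb e.measurableEmbedding]
    exact hprod.congr (Filter.Eventually.of_forall fun z => (hfe z).symm)
  have hfour : ∀ w, 𝓕 f (e w) = (𝓕 φ) w.2 • 𝓕 g w.1 := by
    intro w
    rw [fourier_euclideanConsEquiv, SchwartzMap.fourier_coe, Real.fourier_eq, Real.fourier_eq,
      ← integral_prod_smul, ← integral_prod_swap, Measure.volume_eq_prod]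
    refine integral_congr_ae (Filter.Eventually.of_forall fun z => ?_)
    simp only [Prod.fst_swap, Prod.snd_swap]
    rw [show f (euclideanConsEquiv n z) = φ z.2 • g z.1 from hfe z]
    simp only [Circle.smul_def, Circle.coe_mul, smul_eq_mul, smul_smul]
    congr 1
    ring
  have hsplit : ∀ (u : ℝ → X) (ψ : 𝓢(EuclideanSpace ℝ (Fin n), ℂ))
      (F : EuclideanSpace ℝ (Fin (n + 1)) → X) (c : ℝ), 0 < c → AEStronglyMeasurable u volume →
      (∀ z, F (e z) = ψ z.2 • u z.1) →
      ∫⁻ v, ‖F v‖ₑ ^ c = (∫⁻ x, ‖u x‖ₑ ^ c) * ∫⁻ y, ‖ψ y‖ₑ ^ c := by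
    intro u ψ F c hc hu hF
    rw [← he.lintegral_comp_emb e.measurableEmbedding, ← lintegral_prod_mul
      (hu.enorm.pow_const c) (ψ.continuous.enorm.measurable.pow_const c).aemeasurable]
    refine lintegral_congr fun z => ?_
    rw [hF, enorm_smul, ENNReal.mul_rpow_of_nonneg _ _ hc.le, mul_comm]
  have hmain := hC f hfi
  rw [hsplit g φ f a ha hg.1 hfe,
    hsplit (𝓕 g) (𝓕 φ) (𝓕 f) b hb (continuous_fourier hg).aestronglyMeasurable hfour,
    ENNReal.mul_rpow_of_nonneg _ _ (by positivity), ← hΦ, ← hΨ] at hmain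
  calc ∫⁻ x, ‖𝓕 g x‖ₑ ^ b = Ψ⁻¹ * ((∫⁻ x, ‖𝓕 g x‖ₑ ^ b) * Ψ) := by
        rw [mul_comm, mul_assoc, ENNReal.mul_inv_cancel hΨ0 hΨt, mul_one]
    _ ≤ Ψ⁻¹ * (C * ((∫⁻ x, ‖g x‖ₑ ^ a) ^ (b / a) * Φ ^ (b / a))) := by gcongr
    _ = _ := by ring

/-- Hausdorff–Young in dimensions one and `n` gives it in dimension `n + 1`: the two partial
Fourier transforms are estimated in turn, and the mixed norms are exchanged by Minkowski's integral
inequality, as `a ≤ b`. -/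
theorem FourierBound.succ {n : ℕ} {a b : ℝ} (ha : 0 < a) (hab : a ≤ b)
    (h₁ : FourierBound ℝ X a b) (h₂ : FourierBound (EuclideanSpace ℝ (Fin n)) X a b) :
    FourierBound (EuclideanSpace ℝ (Fin (n + 1))) X a b := by
  obtain ⟨C₁, -, hC₁⟩ := h₁
  obtain ⟨C₂, -, hC₂⟩ := h₂
  have hb : 0 < b := ha.trans_le hab
  refine FourierBound.of_stronglyMeasurable (C := C₁ * C₂) (fun f hfm hf => ?_) (by positivity)
  set e := euclideanConsEquiv n
  have he : MeasurePreserving e := measurePreserving_euclideanConsEquiv n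
  set F : ℝ × EuclideanSpace ℝ (Fin n) → X := fun z => f (e z) with hF
  have hFm : StronglyMeasurable F := hfm.comp_measurable e.measurable
  have hFi : Integrable F := (he.integrable_comp_emb e.measurableEmbedding).2 hf
  -- The partial Fourier transform in the last `n` variables.
  set h : ℝ → EuclideanSpace ℝ (Fin n) → X := fun x η => 𝓕 (fun y => F (x, y)) η with hh
  have hhm : StronglyMeasurable (Function.uncurry h) := by
    have h0 : StronglyMeasurable fun w : (ℝ × EuclideanSpace ℝ (Fin n)) ×
        EuclideanSpace ℝ (Fin n) => Real.fourierChar (-⟪w.2, w.1.2⟫) • F (w.1.1, w.2) := by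
      refine StronglyMeasurable.smul ?_ (hFm.comp_measurable (by fun_prop))
      exact Continuous.stronglyMeasurable (by fun_prop)
    exact h0.integral_prod_right
  have hint : ∀ η : EuclideanSpace ℝ (Fin n),
      Integrable fun z : ℝ × EuclideanSpace ℝ (Fin n) => Real.fourierChar (-⟪z.2, η⟫) • F z := by
    intro η
    refine hFi.mono (StronglyMeasurable.aestronglyMeasurable
      (StronglyMeasurable.smul (Continuous.stronglyMeasurable (by fun_prop)) hFm))
      (Filter.Eventually.of_forall fun z => ?_)
    rw [Circle.norm_smul]
  have hhi : ∀ η, Integrable fun x => h x η := fun η => (hint η).integral_prod_left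
  have hfour : ∀ ξ η, 𝓕 f (e (ξ, η)) = 𝓕 (fun x => h x η) ξ := by
    intro ξ η
    rw [fourier_euclideanConsEquiv, Real.fourier_eq]
    rw [Measure.volume_eq_prod, integral_prod]
    · refine integral_congr_ae (Filter.Eventually.of_forall fun x => ?_)
      simp only [hh, mul_smul]
      rw [Real.fourier_eq, Circle.smul_def, ← integral_smul]
      rfl
    · refine (hint η).mono (StronglyMeasurable.aestronglyMeasurable
        (StronglyMeasurable.smul (Continuous.stronglyMeasurable (by fun_prop)) hFm))
        (Filter.Eventually.of_forall fun z => ?_)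
      rw [Circle.norm_smul, Circle.norm_smul]
  have hslice : ∀ᵐ x : ℝ, Integrable fun y => F (x, y) := hFi.prod_right_ae
  calc ∫⁻ v, ‖𝓕 f v‖ₑ ^ b = ∫⁻ η, ∫⁻ ξ, ‖𝓕 (fun x => h x η) ξ‖ₑ ^ b := by
        rw [← he.lintegral_comp_emb e.measurableEmbedding, Measure.volume_eq_prod,
          lintegral_prod_symm]
        · simp_rw [hfour]
        · exact (((continuous_fourier hf).enorm.measurable.comp e.measurable).pow_const
            b).aemeasurable
    _ ≤ ∫⁻ η, C₁ * (∫⁻ x, ‖h x η‖ₑ ^ a) ^ (b / a) := lintegral_mono fun η => hC₁ _ (hhi η)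
    _ ≤ C₁ * (∫⁻ x, (∫⁻ η, (‖h x η‖ₑ ^ a) ^ (b / a)) ^ (1 / (b / a))) ^ (b / a) := by
        rw [lintegral_const_mul' _ _ ENNReal.coe_ne_top]
        gcongr
        exact lintegral_rpow_lintegral_le (g := fun x η => ‖h x η‖ₑ ^ a)
          (hhm.enorm.pow_const a) ((one_le_div ha).2 hab)
    _ ≤ C₁ * (∫⁻ x, C₂ ^ (a / b) * ∫⁻ y, ‖F (x, y)‖ₑ ^ a) ^ (b / a) := by
        gcongr C₁ * ?_ ^ _
        refine lintegral_mono_ae ?_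
        filter_upwards [hslice] with x hx
        rw [one_div_div]
        calc _ = (∫⁻ η, ‖h x η‖ₑ ^ b) ^ (a / b) := by
              congr 1
              refine lintegral_congr fun η => ?_
              rw [← ENNReal.rpow_mul, mul_div_cancel₀ _ ha.ne']
          _ ≤ (C₂ * (∫⁻ y, ‖F (x, y)‖ₑ ^ a) ^ (b / a)) ^ (a / b) := by
              gcongr
              exact hC₂ _ hx
          _ = _ := by
              rw [ENNReal.mul_rpow_of_nonneg _ _ (by positivity), ← ENNReal.rpow_mul,
                div_mul_div_cancel₀ ha.ne', div_self hb.ne', ENNReal.rpow_one]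
    _ = _ := by
        rw [lintegral_const_mul' _ _ (ENNReal.rpow_ne_top_of_nonneg (by positivity)
            ENNReal.coe_ne_top),
          ENNReal.mul_rpow_of_nonneg _ _ (by positivity), ← ENNReal.rpow_mul,
          div_mul_div_cancel₀ hb.ne', div_self ha.ne', ENNReal.rpow_one, ← mul_assoc,
          ENNReal.coe_mul, ← he.lintegral_comp_emb e.measurableEmbedding, Measure.volume_eq_prod,
          lintegral_prod]
        exact (hFm.enorm.pow_const a).aemeasurable

theorem volume_euclideanSpace_fin_zero :
    (volume : Measure (EuclideanSpace ℝ (Fin 0))) = Measure.dirac 0 := by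
  rw [← (PiLp.volume_preserving_toLp (Fin 0)).map_eq, Measure.volume_pi_eq_dirac 0,
    Measure.map_dirac' (WithLp.measurable_toLp 2 _)]
  rfl

theorem FourierBound.euclideanSpace {a b : ℝ} (ha : 0 < a) (hab : a ≤ b)
    (h : FourierBound ℝ X a b) (n : ℕ) : FourierBound (EuclideanSpace ℝ (Fin n)) X a b := by
  induction n with
  | zero =>
    -- In dimension zero the volume is a Dirac mass and `L^1 → L^∞` is the claim.
    refine ⟨1, one_ne_zero, fun f _ => ?_⟩
    have hb : 0 < b := ha.trans_le hab
    have h0 := enorm_fourier_le f 0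
    rw [volume_euclideanSpace_fin_zero, lintegral_dirac] at h0
    rw [volume_euclideanSpace_fin_zero, lintegral_dirac, lintegral_dirac, ← ENNReal.rpow_mul,
      mul_div_cancel₀ _ ha.ne', ENNReal.coe_one, one_mul]
    gcongr
  | succ n ih => exact h.succ ha hab ih

/-- Fourier type does not depend on the dimension. -/
theorem HasFourierType.fourierBound [CompleteSpace X] {p p' : ℝ≥0∞} (hX : HasFourierType X p)
    (hp : 1 < p) (hpp : ENNReal.HolderConjugate p p') (h0 : 0 < p.toReal)
    (hle : p.toReal ≤ p'.toReal) (d : ℕ) :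
    FourierBound (EuclideanSpace ℝ (Fin d)) X p.toReal p'.toReal := by
  obtain ⟨n, hn⟩ := hX.exists_fourierBound hp hpp
  exact (hn.real_of_succ h0 (h0.trans_le hle)).euclideanSpace h0 hle d

end Dimension

/-! ### Weak and strong type estimates for truncated multipliers -/

section MultiplierBounds

variable {X Y : Type*} [NormedAddCommGroup X] [NormedSpace ℂ X] [NormedAddCommGroup Y]
  [NormedSpace ℂ Y] {d : ℕ}

theorem HasWeakBound.fourierInv {V : Type*} [NormedAddCommGroup V] [InnerProductSpace ℝ V]
    [FiniteDimensional ℝ V] [MeasurableSpace V] [BorelSpace V] {f : V → X} {p B : ℝ}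
    (h : HasWeakBound (𝓕 f) p B volume) : HasWeakBound (𝓕⁻ f) p B volume := by
  intro t ht
  refine le_trans (le_of_eq ?_) (h t ht)
  rw [← Measure.measure_preimage_neg]
  congr 1
  ext ξ
  simp [Real.fourierInv_eq_fourier_neg]

/-- The Fourier multiplier with symbol `m` is of weak type `(p, q)`: the chain
`L^(p,∞) → L^(p',∞) → L^(q',∞) → L^(q,∞)` consists of the weak Hausdorff–Young inequality, the weak
Hölder inequality and once more the weak Hausdorff–Young inequality. -/
theorem exists_hasWeakBound_multiplier {a b c e p q r : ℝ}
    (hX : FourierBound (EuclideanSpace ℝ (Fin d)) X a b)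
    (hY : FourierBound (EuclideanSpace ℝ (Fin d)) Y c e)
    (hab : 1 / a + 1 / b = 1) (hce : 1 / c + 1 / e = 1) (hp : 1 < p) (hpa : p < a) (he : 1 < e)
    (heq : e < q) (hr : 0 < r) (hpqr : 1 / r = 1 / p - 1 / q) :
    ∃ K : ℝ, 0 < K ∧ ∀ m : EuclideanSpace ℝ (Fin d) → X →L[ℂ] Y, ∀ A : ℝ, 0 < A →
      HasWeakBound m r A volume → ∀ f : EuclideanSpace ℝ (Fin d) → X, Integrable f →
      Integrable (fun ξ => m ξ (𝓕 f ξ)) → ∀ B : ℝ, 0 < B → HasWeakBound f p B volume →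
      HasWeakBound (𝓕⁻ fun ξ => m ξ (𝓕 f ξ)) q (K * (A * B)) volume := by
  have hp0 : 0 < p := by linarith
  have hq0 : 0 < q := by linarith
  have he0 : 0 < e := by linarith
  have hp1 : 0 < p - 1 := by linarith
  have hq1 : 0 < q - 1 := by linarith
  have he1 : 0 < e - 1 := by linarith
  have hpp : 1 / p + 1 / (p / (p - 1)) = 1 := by field_simp; ring
  have hqq : 1 / (q / (q - 1)) + 1 / q = 1 := by field_simp; ring
  have hc : c = e / (e - 1) := by
    have : c ≠ 0 := by rintro rfl; simp at hce; linarith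
    field_simp at hce ⊢; linarith
  obtain ⟨K₁, hK₁, h₁⟩ := hX.exists_hasWeakBound hab hpp hp hpa
  obtain ⟨K₂, hK₂, h₂⟩ := hY.exists_hasWeakBound hce hqq
    (by rw [lt_div_iff₀ hq1]; linarith)
    (by rw [hc, div_lt_div_iff₀ hq1 he1]; linarith)
  refine ⟨K₂ * (2 ^ (1 / (q / (q - 1))) * K₁), by positivity, fun m A hA hm f hf hG B hB hw => ?_⟩
  have hF := h₁ f hf B hB hw
  have hmul := HasWeakBound.mul (w := fun ξ => m ξ (𝓕 f ξ)) (fun ξ => (m ξ).le_opNorm _) hr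
    (by positivity) (by positivity : 0 < q / (q - 1)) (by linarith) hA (by positivity) hm hF
  have := (h₂ _ hG _ (by positivity) hmul).fourierInv
  convert this using 1
  ring

/-- The strong type `(p, q)` bound for multipliers whose symbols map Fourier transforms of integrable
functions to integrable functions, obtained by interpolation along `1 / p - 1 / q = 1 / r`. -/
theorem exists_lintegral_multiplier_le {a b c e p q r : ℝ}
    (hX : FourierBound (EuclideanSpace ℝ (Fin d)) X a b)
    (hY : FourierBound (EuclideanSpace ℝ (Fin d)) Y c e)
    (hab : 1 / a + 1 / b = 1) (hce : 1 / c + 1 / e = 1) (hp : 1 < p) (hpa : p < a) (he : 1 < e)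
    (heq : e < q) (hpq : p ≤ q) (hr : 0 < r) (hpqr : 1 / r = 1 / p - 1 / q) :
    ∃ K : ℝ, 0 < K ∧ ∀ m : EuclideanSpace ℝ (Fin d) → X →L[ℂ] Y, ∀ A : ℝ, 0 < A →
      HasWeakBound m r A volume →
      (∀ f : EuclideanSpace ℝ (Fin d) → X, Integrable f → Integrable (fun ξ => m ξ (𝓕 f ξ))) →
      ∀ f : EuclideanSpace ℝ (Fin d) → X, StronglyMeasurable f → Integrable f →
      ∀ M : ℝ, 0 < M → ∫⁻ x, ‖f x‖ₑ ^ p ≤ ENNReal.ofReal (M ^ p) →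
      ∫⁻ x, ‖(𝓕⁻ fun ξ => m ξ (𝓕 f ξ)) x‖ₑ ^ q ≤ ENNReal.ofReal ((K * (A * M)) ^ q) := by
  have hp0 : 0 < p := by linarith
  have hq0 : 0 < q := by linarith
  have he0 : 0 < e := by linarith
  have ha0 : 0 < a := by linarith
  -- The exponents `1 / p ± ε` and `1 / q ± ε` stay in the admissible range.
  obtain ⟨ε, hε, hε₁, hε₂, hε₃, hε₄⟩ : ∃ ε : ℝ, 0 < ε ∧ ε < 1 - 1 / p ∧ ε < 1 / e - 1 / q ∧
      ε < 1 / p - 1 / a ∧ ε < 1 / q := by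
    have h1 : 0 < 1 - 1 / p := by rw [sub_pos, div_lt_one hp0]; exact hp
    have h2 : 0 < 1 / e - 1 / q := sub_pos.2 (one_div_lt_one_div_of_lt he0 heq)
    have h3 : 0 < 1 / p - 1 / a := sub_pos.2 (one_div_lt_one_div_of_lt hp0 hpa)
    have h4 : 0 < 1 / q := by positivity
    refine ⟨min (min (1 - 1 / p) (1 / e - 1 / q)) (min (1 / p - 1 / a) (1 / q)) / 2,
      by positivity, ?_, ?_, ?_, ?_⟩
    all_goals
      rw [div_lt_iff₀ two_pos]
      first
      | linarith [min_le_left (min (1 - 1 / p) (1 / e - 1 / q)) (min (1 / p - 1 / a) (1 / q)),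
          min_le_left (1 - 1 / p) (1 / e - 1 / q)]
      | linarith [min_le_left (min (1 - 1 / p) (1 / e - 1 / q)) (min (1 / p - 1 / a) (1 / q)),
          min_le_right (1 - 1 / p) (1 / e - 1 / q)]
      | linarith [min_le_right (min (1 - 1 / p) (1 / e - 1 / q)) (min (1 / p - 1 / a) (1 / q)),
          min_le_left (1 / p - 1 / a) (1 / q)]
      | linarith [min_le_right (min (1 - 1 / p) (1 / e - 1 / q)) (min (1 / p - 1 / a) (1 / q)),
          min_le_right (1 / p - 1 / a) (1 / q)]
  have hpinv : 0 < 1 / p := by positivity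
  have hqinv : 0 < 1 / q := by positivity
  have hainv : 0 < 1 / a := by positivity
  have hle : 1 / q ≤ 1 / p := one_div_le_one_div_of_le hp0 hpq
  set p₁ : ℝ := 1 / (1 / p + ε) with hp₁
  set q₁ : ℝ := 1 / (1 / q + ε) with hq₁
  set p₂ : ℝ := 1 / (1 / p - ε) with hp₂
  set q₂ : ℝ := 1 / (1 / q - ε) with hq₂
  have d₁ : 0 < 1 / p + ε := by linarith
  have d₂ : 0 < 1 / q + ε := by linarith
  have d₃ : 0 < 1 / p - ε := by linarith
  have d₄ : 0 < 1 / q - ε := by linarith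
  have hp₁0 : 0 < p₁ := by positivity
  have hq₁0 : 0 < q₁ := by positivity
  have hp₂0 : 0 < p₂ := by positivity
  have hq₂0 : 0 < q₂ := by positivity
  have i₁ : 1 / p₁ = 1 / p + ε := by rw [hp₁, one_div_one_div]
  have i₂ : 1 / q₁ = 1 / q + ε := by rw [hq₁, one_div_one_div]
  have i₃ : 1 / p₂ = 1 / p - ε := by rw [hp₂, one_div_one_div]
  have i₄ : 1 / q₂ = 1 / q - ε := by rw [hq₂, one_div_one_div]
  have h1p₁ : 1 < p₁ := by rw [hp₁, lt_div_iff₀ d₁]; linarith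
  have hp₁p : p₁ < p := lt_of_one_div_lt_one_div hp0 (by rw [i₁]; linarith)
  have hpp₂ : p < p₂ := lt_of_one_div_lt_one_div hp₂0 (by rw [i₃]; linarith)
  have hp₂a : p₂ < a := lt_of_one_div_lt_one_div ha0 (by rw [i₃]; linarith)
  have heq₁ : e < q₁ := lt_of_one_div_lt_one_div hq₁0 (by rw [i₂]; linarith)
  have hq₁q : q₁ < q := lt_of_one_div_lt_one_div hq0 (by rw [i₂]; linarith)
  have hqq₂ : q < q₂ := lt_of_one_div_lt_one_div hq₂0 (by rw [i₄]; linarith)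
  have hpq₁ : p₁ ≤ q₁ := le_of_one_div_le_one_div hq₁0 (by rw [i₁, i₂]; linarith)
  have hpq₂ : p₂ ≤ q₂ := le_of_one_div_le_one_div hq₂0 (by rw [i₃, i₄]; linarith)
  obtain ⟨K₁, hK₁, h₁⟩ := exists_hasWeakBound_multiplier hX hY hab hce h1p₁ (hp₁p.trans hpa) he
    heq₁ hr (by rw [hpqr, i₁, i₂]; ring)
  obtain ⟨K₂, hK₂, h₂⟩ := exists_hasWeakBound_multiplier hX hY hab hce (hp.trans hpp₂) hp₂a he
    (heq.trans hqq₂) hr (by rw [hpqr, i₃, i₄]; ring)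
  set κ : ℝ := q * (2 ^ q₁ / (q - q₁) + 2 ^ q₂ / (q₂ - q)) with hκ
  have hκ0 : 0 < κ :=
    mul_pos hq0 (add_pos (div_pos (by positivity) (by linarith))
      (div_pos (by positivity) (by linarith)))
  set D := max K₁ K₂ with hD
  have hD0 : 0 < D := lt_max_of_lt_left hK₁
  refine ⟨κ ^ (1 / q) * D, by positivity, fun m A hA hm hmi f hfm hf M hM hfM => ?_⟩
  have hweak : ∀ (u v K : ℝ), 0 < u → 0 < v → 0 < K → K ≤ D →
      (∀ f : EuclideanSpace ℝ (Fin d) → X, Integrable f →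
        ∀ B : ℝ, 0 < B → HasWeakBound f u B volume →
        HasWeakBound (𝓕⁻ fun ξ => m ξ (𝓕 f ξ)) v (K * (A * B)) volume) →
      ∀ f : EuclideanSpace ℝ (Fin d) → X, Integrable f → ∀ t : ℝ, 0 < t →
        volume {x | t < ‖(𝓕⁻ fun ξ => m ξ (𝓕 f ξ)) x‖} ≤
          ENNReal.ofReal ((D * A / t) ^ v) * (∫⁻ x, ‖f x‖ₑ ^ u) ^ (v / u) := by
    intro u v K hu hv hK hKD h g hg t ht
    refine le_mul_rpow_of_forall_le ?_ ENNReal.ofReal_ne_top hu hv fun B hB hI => ?_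
    · rw [ne_eq, ENNReal.ofReal_eq_zero, not_le]; positivity
    · refine (h g hg B hB (.of_lintegral_le hg.1 hu hB.le hI) t ht).trans ?_
      rw [← ENNReal.ofReal_mul (by positivity), ← Real.mul_rpow (by positivity) hB.le]
      gcongr ENNReal.ofReal (?_ ^ v)
      rw [div_mul_eq_mul_div, mul_assoc]
      gcongr
  have hmain := lintegral_rpow_le_of_weakType
    (T := fun (f : EuclideanSpace ℝ (Fin d) → X) x => ‖(𝓕⁻ fun ξ => m ξ (𝓕 f ξ)) x‖)
    (μ := volume) (ν := volume) hp₁0 hpq₁ hpq₂ hp₁p hpp₂ hq₁q hqq₂ (by rw [i₁, i₂]; ring)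
    (by rw [i₃, i₄]; ring) (fun _ _ => norm_nonneg _) (fun g₁ g₂ hg₁ hg₂ x => by
      have : (fun ξ => m ξ (𝓕 (g₁ + g₂) ξ)) =
          (fun ξ => m ξ (𝓕 g₁ ξ)) + fun ξ => m ξ (𝓕 g₂ ξ) := by
        ext ξ; simp [fourier_add_apply hg₁ hg₂]
      rw [this, fourierInv_add_apply (hmi _ hg₁) (hmi _ hg₂)]
      exact norm_add_le _ _)
    (D := D * A) (by positivity)
    (hweak p₁ q₁ K₁ hp₁0 hq₁0 hK₁ (le_max_left _ _) fun g hg => h₁ m A hA hm g hg (hmi g hg))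
    (hweak p₂ q₂ K₂ hp₂0 hq₂0 hK₂ (le_max_right _ _) fun g hg => h₂ m A hA hm g hg (hmi g hg))
    hf hfm (continuous_fourierInv (hmi f hf)).norm.measurable.aemeasurable hM hfM
  calc ∫⁻ x, ‖(𝓕⁻ fun ξ => m ξ (𝓕 f ξ)) x‖ₑ ^ q
      = ∫⁻ x, ENNReal.ofReal (‖(𝓕⁻ fun ξ => m ξ (𝓕 f ξ)) x‖ ^ q) := by
        refine lintegral_congr fun x => ?_
        rw [← ofReal_norm, ENNReal.ofReal_rpow_of_nonneg (norm_nonneg _) hq0.le]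
    _ ≤ _ := hmain
    _ = _ := by
        congr 1
        rw [mul_assoc (κ ^ (1 / q)), Real.mul_rpow (x := κ ^ (1 / q)) (by positivity)
          (by positivity), ← Real.rpow_mul hκ0.le, one_div_mul_cancel hq0.ne', Real.rpow_one,
          mul_assoc D]

/-! ### Removing the truncation -/

/-- The set on which the symbol `m` and the frequency are bounded by `N`. -/
def symbolTruncationSet (m : EuclideanSpace ℝ (Fin d) → X →L[ℂ] Y) (N : ℕ) :
    Set (EuclideanSpace ℝ (Fin d)) :=
  {ξ | ‖m ξ‖ ≤ N} ∩ Metric.closedBall 0 N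

theorem nullMeasurableSet_symbolTruncationSet {m : EuclideanSpace ℝ (Fin d) → X →L[ℂ] Y}
    (hn : AEStronglyMeasurable (fun ξ => ‖m ξ‖) volume) (N : ℕ) :
    NullMeasurableSet (symbolTruncationSet m N) :=
  (nullMeasurableSet_le hn.aemeasurable aemeasurable_const).inter
    measurableSet_closedBall.nullMeasurableSet

theorem integrable_indicator_symbolTruncationSet {m : EuclideanSpace ℝ (Fin d) → X →L[ℂ] Y}
    (hm : XStronglyMeasurable m) (hn : AEStronglyMeasurable (fun ξ => ‖m ξ‖) volume) (N : ℕ)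
    {f : EuclideanSpace ℝ (Fin d) → X} (hf : Integrable f) :
    Integrable (fun ξ => (symbolTruncationSet m N).indicator m ξ (𝓕 f ξ)) := by
  have hS := nullMeasurableSet_symbolTruncationSet hn N
  have heq : (fun ξ => (symbolTruncationSet m N).indicator m ξ (𝓕 f ξ)) =
      (symbolTruncationSet m N).indicator fun ξ => m ξ (𝓕 f ξ) := by
    ext ξ
    by_cases h : ξ ∈ symbolTruncationSet m N <;> simp [h]
  have hmeas := (hm.apply (continuous_fourier hf).stronglyMeasurable).indicator₀ hS
  rw [heq]
  have hconst : Integrable ((Metric.closedBall (0 : EuclideanSpace ℝ (Fin d)) N).indicator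
      fun _ => (N : ℝ) * (∫⁻ x, ‖f x‖ₑ).toReal) :=
    (integrable_indicator_iff measurableSet_closedBall).2
      (integrableOn_const (measure_closedBall_lt_top).ne)
  refine hconst.mono' hmeas (Filter.Eventually.of_forall fun ξ => ?_)
  by_cases h : ξ ∈ symbolTruncationSet m N
  · rw [Set.indicator_of_mem h, Set.indicator_of_mem h.2]
    refine ((m ξ).le_opNorm _).trans (mul_le_mul h.1 ?_ (norm_nonneg _) (by positivity))
    rw [← toReal_enorm]
    exact ENNReal.toReal_mono hf.2.ne (enorm_fourier_le f ξ)
  · rw [Set.indicator_of_notMem h, norm_zero]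
    exact Set.indicator_nonneg (fun _ _ => by positivity) _

/-- A bound for all truncated multipliers passes to the multiplier itself, by Fatou's lemma. -/
theorem lintegral_multiplier_le_of_truncation {m : EuclideanSpace ℝ (Fin d) → X →L[ℂ] Y}
    (hm : XStronglyMeasurable m) (hn : AEStronglyMeasurable (fun ξ => ‖m ξ‖) volume)
    {f : EuclideanSpace ℝ (Fin d) → X} (hf : Integrable f)
    (hG : Integrable fun ξ => m ξ (𝓕 f ξ)) {q : ℝ} {R : ℝ≥0∞}
    (h : ∀ N, ∫⁻ x, ‖(𝓕⁻ fun ξ => (symbolTruncationSet m N).indicator m ξ (𝓕 f ξ)) x‖ₑ ^ q ≤ R) :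
    ∫⁻ x, ‖(𝓕⁻ fun ξ => m ξ (𝓕 f ξ)) x‖ₑ ^ q ≤ R := by
  have hlim : ∀ x, Filter.Tendsto
      (fun N : ℕ => (𝓕⁻ fun ξ => (symbolTruncationSet m N).indicator m ξ (𝓕 f ξ)) x) Filter.atTop
      (nhds ((𝓕⁻ fun ξ => m ξ (𝓕 f ξ)) x)) := by
    intro x
    simp only [Real.fourierInv_eq]
    refine tendsto_integral_of_dominated_convergence (fun ξ => ‖m ξ (𝓕 f ξ)‖) (fun N => ?_)
      hG.norm (fun N => Filter.Eventually.of_forall fun ξ => ?_)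
      (Filter.Eventually.of_forall fun ξ => ?_)
    · refine AEStronglyMeasurable.fun_smul ?_ (integrable_indicator_symbolTruncationSet hm hn N hf).1
      exact Continuous.aestronglyMeasurable (by fun_prop)
    · rw [Circle.norm_smul]
      by_cases h : ξ ∈ symbolTruncationSet m N <;> simp [h]
    · refine tendsto_const_nhds.congr' ?_
      obtain ⟨n, hn⟩ := exists_nat_ge (max ‖m ξ‖ ‖ξ‖)
      filter_upwards [Filter.eventually_ge_atTop n] with N hN
      have hN' : (n : ℝ) ≤ N := by exact_mod_cast hN
      have : ξ ∈ symbolTruncationSet m N :=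
        ⟨(le_max_left _ _).trans (hn.trans hN'),
          mem_closedBall_zero_iff.2 ((le_max_right _ _).trans (hn.trans hN'))⟩
      rw [Set.indicator_of_mem this]
  have hlim' : ∀ x, Filter.liminf
      (fun N : ℕ => ‖(𝓕⁻ fun ξ => (symbolTruncationSet m N).indicator m ξ (𝓕 f ξ)) x‖ₑ ^ q)
      Filter.atTop = ‖(𝓕⁻ fun ξ => m ξ (𝓕 f ξ)) x‖ₑ ^ q := fun x =>
    ((ENNReal.continuous_rpow_const.tendsto _).comp (hlim x).enorm).liminf_eq
  simp_rw [← hlim']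
  refine (lintegral_liminf_le fun N => ?_).trans ?_
  · exact ((continuous_fourierInv
      (integrable_indicator_symbolTruncationSet hm hn N hf)).enorm.measurable).pow_const q
  · exact Filter.liminf_le_of_frequently_le' (Filter.Frequently.of_forall h)

theorem HasWeakBound.indicator {α E : Type*} [MeasurableSpace α] [NormedAddCommGroup E]
    {μ : Measure α} {f : α → E} {p B : ℝ} (h : HasWeakBound f p B μ) (S : Set α) :
    HasWeakBound (S.indicator f) p B μ := fun t ht =>
  (measure_mono fun x (hx : t < ‖S.indicator f x‖) =>
    hx.trans_le (norm_indicator_le_norm_self f x)).trans (h t ht)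

end MultiplierBounds

/-! ### The extension of the multiplier operator -/

section Extension

variable {X Y : Type*} [NormedAddCommGroup X] [NormedSpace ℂ X] [NormedAddCommGroup Y]
  [NormedSpace ℂ Y] {d : ℕ}

theorem hasWeakBound_of_weakLpNorm_le {α E : Type*} [MeasurableSpace α] [NormedAddCommGroup E]
    {μ : Measure α} {f : α → E} {r : ℝ≥0∞} (hr : r ≠ ∞) (hr0 : 0 < r.toReal) {A : ℝ} (hA : 0 ≤ A)
    (h : weakLpNorm f r μ ≤ ENNReal.ofReal A) : HasWeakBound f r.toReal A μ := by
  intro t ht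
  rw [weakLpNorm, if_neg hr] at h
  have h1 := (le_iSup₂ (f := fun (t : ℝ≥0) (_ : 0 < t) =>
    (t : ℝ≥0∞) * μ {x | (t : ℝ) < ‖f x‖} ^ (1 / r.toReal)) t.toNNReal (by simpa using ht)).trans h
  rw [Real.coe_toNNReal t ht.le] at h1
  have h2 : μ {x | t < ‖f x‖} ^ (1 / r.toReal) ≤ ENNReal.ofReal (A / t) := by
    rw [ENNReal.ofReal_div_of_pos ht, ENNReal.le_div_iff_mul_le (by simp [ht]) (by simp), mul_comm]
    exact h1
  calc μ {x | t < ‖f x‖} = (μ {x | t < ‖f x‖} ^ (1 / r.toReal)) ^ r.toReal := by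
        rw [← ENNReal.rpow_mul, one_div_mul_cancel hr0.ne', ENNReal.rpow_one]
    _ ≤ ENNReal.ofReal (A / t) ^ r.toReal := by gcongr
    _ = _ := ENNReal.ofReal_rpow_of_nonneg (by positivity) hr0.le

/-- A symbol in weak `L^r` with `r > 1` has moderate growth: where it is at most `1` it is
controlled by an integrable power of `1 + ‖ξ‖`, and its large part is integrable. -/
theorem hasModerateGrowth_of_hasWeakBound {m : EuclideanSpace ℝ (Fin d) → X →L[ℂ] Y}
    (hn : AEStronglyMeasurable (fun ξ => ‖m ξ‖) volume) {r A : ℝ} (hr : 1 < r) (hA : 0 ≤ A)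
    (hw : HasWeakBound (fun ξ => ‖m ξ‖) r A volume) : HasModerateGrowth m := by
  refine ⟨d + 1, by positivity, fun ξ => (1 + ‖ξ‖) ^ (-(d + 1 : ℝ)) * ‖m ξ‖, ?_, fun ξ => le_rfl⟩
  have h1 : Integrable fun ξ : EuclideanSpace ℝ (Fin d) => (1 + ‖ξ‖) ^ (-(d + 1 : ℝ)) :=
    integrable_one_add_norm (by simp)
  have h2 : Integrable ({ξ | 1 < ‖‖m ξ‖‖}.indicator fun ξ => ‖m ξ‖) :=
    ⟨aestronglyMeasurable_indicator_lt hn 1,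
      (hw.lintegral_indicator_lt_le hn hr hA one_pos).trans_lt ENNReal.ofReal_lt_top⟩
  refine (h1.add h2).mono' (h1.1.mul hn) (Filter.Eventually.of_forall fun ξ => ?_)
  have hpos : 0 ≤ (1 + ‖ξ‖) ^ (-(d + 1 : ℝ)) := by positivity
  rw [norm_mul, norm_norm, Real.norm_of_nonneg hpos, Pi.add_apply]
  by_cases h : 1 < ‖m ξ‖
  · rw [Set.indicator_of_mem (by simpa using h)]
    have : (1 + ‖ξ‖) ^ (-(d + 1 : ℝ)) ≤ 1 :=
      Real.rpow_le_one_of_one_le_of_nonpos (by linarith [norm_nonneg ξ])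
        (by have : (0 : ℝ) ≤ d := Nat.cast_nonneg d
            linarith)
    nlinarith [norm_nonneg (m ξ)]
  · rw [Set.indicator_of_notMem (by simpa using h)]
    nlinarith [norm_nonneg (m ξ)]

theorem toTemperedDistribution_injective {V : Type*} [NormedAddCommGroup V]
    [InnerProductSpace ℝ V] [FiniteDimensional ℝ V] [MeasurableSpace V] [BorelSpace V]
    [CompleteSpace X] {p : ℝ≥0∞} [Fact (1 ≤ p)] {f g : Lp X p (volume : Measure V)}
    (h : Lp.toTemperedDistribution f = Lp.toTemperedDistribution g) : f = g := by
  have h1 := Lp.ker_toTemperedDistributionCLM_eq_bot (F := X) (μ := (volume : Measure V)) (p := p)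
  rw [LinearMap.ker_eq_bot] at h1
  exact h1 h

/-- On Schwartz functions the multiplier operator is given by the Fourier integral
`𝓕⁻ (m · 𝓕 f)`. -/
theorem toTemperedDistribution_toLp_fourierInv [CompleteSpace Y] {q : ℝ≥0∞} [Fact (1 ≤ q)]
    {m : EuclideanSpace ℝ (Fin d) → X →L[ℂ] Y} (hm : XStronglyMeasurable m)
    (hg : HasModerateGrowth m) (f : 𝓢(EuclideanSpace ℝ (Fin d), X))
    (hL : MemLp (𝓕⁻ fun ξ => m ξ (𝓕 (f : EuclideanSpace ℝ (Fin d) → X) ξ)) q volume) :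
    Lp.toTemperedDistribution hL.toLp = fourierMultiplierOp m hm hg f := by
  have hG := memLp_one_apply_schwartz hm hg (𝓕 f)
  ext φ
  rw [fourierMultiplierOp, TemperedDistribution.fourierInv_apply, Lp.toTemperedDistribution_apply,
    Lp.toTemperedDistribution_apply]
  calc _ = ∫ x, φ x • (𝓕⁻ fun ξ => m ξ ((𝓕 f) ξ)) x := by
        refine integral_congr_ae ?_
        filter_upwards [hL.coeFn_toLp] with x hx
        rw [hx]
        rfl
    _ = ∫ x, (𝓕⁻ φ) x • m x ((𝓕 f) x) :=
        (integral_schwartz_smul_fourierInv (memLp_one_iff_integrable.1 hG) φ).symm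
    _ = _ := by
        refine integral_congr_ae ?_
        filter_upwards [hG.coeFn_toLp] with x hx
        rw [hx]

/-- A norm bound for `𝓕⁻ (m · 𝓕 f)` on Schwartz functions yields a unique bounded extension of the
multiplier operator. -/
theorem exists_unique_extendsMultiplierOp [CompleteSpace X] [CompleteSpace Y] {p q : ℝ≥0∞}
    [Fact (1 ≤ p)] [Fact (1 ≤ q)] (hp : p ≠ ∞)
    {m : EuclideanSpace ℝ (Fin d) → X →L[ℂ] Y} (hm : XStronglyMeasurable m)
    (hg : HasModerateGrowth m) {N : ℝ} (hN : 0 ≤ N)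
    (hL : ∀ f : 𝓢(EuclideanSpace ℝ (Fin d), X),
      MemLp (𝓕⁻ fun ξ => m ξ (𝓕 (f : EuclideanSpace ℝ (Fin d) → X) ξ)) q volume)
    (hbound : ∀ f : 𝓢(EuclideanSpace ℝ (Fin d), X), ‖(hL f).toLp‖ ≤ N * ‖f.toLp p volume‖) :
    ∃ T : Lp X p (volume : Measure (EuclideanSpace ℝ (Fin d))) →L[ℂ]
        Lp Y q (volume : Measure (EuclideanSpace ℝ (Fin d))),
      ExtendsMultiplierOp m hm hg T ∧
      (∀ T' : Lp X p (volume : Measure (EuclideanSpace ℝ (Fin d))) →L[ℂ]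
        Lp Y q (volume : Measure (EuclideanSpace ℝ (Fin d))),
        ExtendsMultiplierOp m hm hg T' → T' = T) ∧ ‖T‖ ≤ N := by
  have hint : ∀ f : 𝓢(EuclideanSpace ℝ (Fin d), X),
      Integrable fun ξ => m ξ (𝓕 (f : EuclideanSpace ℝ (Fin d) → X) ξ) := fun f =>
    memLp_one_iff_integrable.1 (memLp_one_apply_schwartz hm hg (𝓕 f))
  let L : 𝓢(EuclideanSpace ℝ (Fin d), X) →ₗ[ℂ]
      Lp Y q (volume : Measure (EuclideanSpace ℝ (Fin d))) :=
    { toFun := fun f => (hL f).toLp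
      map_add' := fun f g => by
        rw [← MemLp.toLp_add]
        refine MemLp.toLp_congr _ _ (Filter.Eventually.of_forall fun x => ?_)
        rw [Pi.add_apply, ← fourierInv_add_apply (hint f) (hint g)]
        refine congrArg (fun G : EuclideanSpace ℝ (Fin d) → Y => 𝓕⁻ G x) (funext fun ξ => ?_)
        rw [Pi.add_apply, ← map_add, ← fourier_add_apply f.integrable g.integrable]
        rfl
      map_smul' := fun c f => by
        rw [RingHom.id_apply, ← MemLp.toLp_const_smul]
        refine MemLp.toLp_congr _ _ (Filter.Eventually.of_forall fun x => ?_)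
        rw [Pi.smul_apply, Real.fourierInv_eq, Real.fourierInv_eq, ← integral_smul]
        refine integral_congr_ae (Filter.Eventually.of_forall fun ξ => ?_)
        have : 𝓕 ((c • f : 𝓢(EuclideanSpace ℝ (Fin d), X)) : EuclideanSpace ℝ (Fin d) → X) ξ =
            c • 𝓕 (f : EuclideanSpace ℝ (Fin d) → X) ξ := by
          rw [Real.fourier_eq, Real.fourier_eq, ← integral_smul]
          refine integral_congr_ae (Filter.Eventually.of_forall fun y => ?_)
          exact smul_comm _ c (f y)
        simp only [this, map_smul]
        exact smul_comm _ c _ }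
  let ι : 𝓢(EuclideanSpace ℝ (Fin d), X) →ₗ[ℂ]
      Lp X p (volume : Measure (EuclideanSpace ℝ (Fin d))) := (toLpCLM ℂ X p volume).toLinearMap
  have hdense : DenseRange ι := denseRange_toLpCLM hp
  have hLb : ∀ f, ‖L f‖ ≤ N * ‖ι f‖ := hbound
  set T := L.extendOfNorm ι with hT
  have hext : ExtendsMultiplierOp m hm hg T := by
    intro f
    have h1 : T (f.toLp p volume) = (hL f).toLp :=
      LinearMap.extendOfNorm_eq (f := L) hdense ⟨N, hLb⟩ f
    rw [h1, toTemperedDistribution_toLp_fourierInv]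
  refine ⟨T, hext, fun T' hT' => ?_, LinearMap.opNorm_extendOfNorm_le hdense hN hLb⟩
  refine ContinuousLinearMap.ext fun u => ?_
  refine congrFun (hdense.equalizer T'.continuous T.continuous (funext fun f => ?_)) u
  exact toTemperedDistribution_injective ((hT' f).trans (hext f).symm)

end Extension

theorem mainTheorem2 {X Y : Type*}
    [NormedAddCommGroup X] [NormedSpace ℂ X] [CompleteSpace X]
    [NormedAddCommGroup Y] [NormedSpace ℂ Y] [CompleteSpace Y]
    (d : ℕ) (hd : 1 ≤ d) (p₀ q₀ p q r : ℝ≥0∞) [Fact (1 ≤ p)] [Fact (1 ≤ q)]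
    (hp₀ : 1 < p₀) (hp₀' : p₀ ≤ 2) (hX : HasFourierType X p₀)
    (hq₀ : 2 ≤ q₀) (hq₀' : q₀ < ∞) (hY : HasFourierCotype Y q₀)
    (hp : 1 < p) (hp' : p < p₀) (hq : q₀ < q) (hq' : q < ∞)
    (hr : 1 ≤ r) (hpqr : 1 / r = 1 / p - 1 / q) :
    ∃ C : ℝ, 0 ≤ C ∧
      ∀ (m : EuclideanSpace ℝ (Fin d) → X →L[ℂ] Y) (hm : XStronglyMeasurable m),
        MemWeakLp (fun ξ => ‖m ξ‖) r volume →
        ∃ (hg : HasModerateGrowth m)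
          (T : Lp X p (volume : Measure (EuclideanSpace ℝ (Fin d))) →L[ℂ]
            Lp Y q (volume : Measure (EuclideanSpace ℝ (Fin d)))),
          ExtendsMultiplierOp m hm hg T ∧
          (∀ T' : Lp X p (volume : Measure (EuclideanSpace ℝ (Fin d))) →L[ℂ]
            Lp Y q (volume : Measure (EuclideanSpace ℝ (Fin d))),
            ExtendsMultiplierOp m hm hg T' → T' = T) ∧
          ‖T‖ ≤ C * (weakLpNorm (fun ξ => ‖m ξ‖) r volume).toReal := by
  -- Passage to real exponents.
  have hp₀t : p₀ ≠ ∞ := (hp₀'.trans_lt (by simp)).ne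
  have hpt : p ≠ ∞ := (hp'.trans_le le_top).ne
  have hp0 : p ≠ 0 := (zero_lt_one.trans hp).ne'
  have hq0 : q ≠ 0 := (zero_lt_one.trans_le (Fact.out : 1 ≤ q)).ne'
  have hq₀1 : 1 < q₀ := lt_of_lt_of_le (by norm_num) hq₀
  have hpq : p < q := hp'.trans_le (hp₀'.trans (hq₀.trans hq.le))
  have one_lt_toReal : ∀ {s : ℝ≥0∞}, s ≠ ∞ → 1 < s → 1 < s.toReal := fun hs h => by
    simpa using (ENNReal.toReal_lt_toReal ENNReal.one_ne_top hs).2 h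
  have h1p : 1 < p.toReal := one_lt_toReal hpt hp
  have h1p₀ : 1 < p₀.toReal := one_lt_toReal hp₀t hp₀
  have h1q₀ : 1 < q₀.toReal := one_lt_toReal hq₀'.ne hq₀1
  have h1q : 1 < q.toReal := one_lt_toReal hq'.ne (hq₀1.trans hq)
  have hpp₀ : p.toReal < p₀.toReal := (ENNReal.toReal_lt_toReal hpt hp₀t).2 hp'
  have hq₀q : q₀.toReal < q.toReal := (ENNReal.toReal_lt_toReal hq₀'.ne hq'.ne).2 hq
  have hpqR : p.toReal < q.toReal := (ENNReal.toReal_lt_toReal hpt hq'.ne).2 hpq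
  have hline : 1 / r.toReal = 1 / p.toReal - 1 / q.toReal := by
    have h := congrArg ENNReal.toReal hpqr
    rw [ENNReal.toReal_sub_of_le (ENNReal.div_le_div_left hpq.le 1) (by simp [hp0])] at h
    simpa using h
  have hrinv : 0 < 1 / r.toReal := by
    rw [hline, sub_pos]
    exact one_div_lt_one_div_of_lt (by linarith) hpqR
  have hr0 : 0 < r.toReal := one_div_pos.1 hrinv
  have hrt : r ≠ ∞ := by rintro rfl; simp at hr0
  have h1r : 1 < r.toReal := by
    refine (one_div_lt_one_div hr0 one_pos).1 ?_
    have h1 : 1 / p.toReal < 1 := by rw [div_lt_one (by linarith)]; exact h1p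
    have h2 : 0 < 1 / q.toReal := by positivity
    rw [hline, div_one]
    linarith
  -- The Hausdorff–Young inequalities in dimension `d`.
  have two : (2 : ℝ≥0∞).toReal = 2 := by simp
  have hp₀2 : p₀.toReal ≤ 2 := two ▸ ENNReal.toReal_mono (by simp) hp₀'
  have hq₀2 : 2 ≤ q₀.toReal := two ▸ ENNReal.toReal_mono hq₀'.ne hq₀
  obtain ⟨p₀', hp₀c⟩ : ∃ p₀' : ℝ≥0∞, ENNReal.HolderConjugate p₀ p₀' :=
    ⟨_, ENNReal.HolderConjugate.conjExponent hp₀.le⟩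
  have hp₀ct : p₀' ≠ ∞ := ((ENNReal.HolderConjugate.lt_top_iff_one_lt p₀' p₀).2 hp₀).ne
  have hp₀R : p₀.toReal.HolderConjugate p₀'.toReal :=
    ENNReal.HolderConjugate.toReal_of_ne_top hp₀t hp₀ct
  have hXd := hX.fourierBound hp₀ hp₀c (by linarith)
    (by have := hp₀R.conjugate_eq
        rw [this, le_div_iff₀ (by linarith)]
        nlinarith) d
  obtain ⟨q₀', hq₀c, hYq⟩ := hY
  have hq₀ct : q₀' ≠ ∞ := ((ENNReal.HolderConjugate.lt_top_iff_one_lt q₀' q₀).2 hq₀1).ne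
  have hq₀R : q₀.toReal.HolderConjugate q₀'.toReal :=
    ENNReal.HolderConjugate.toReal_of_ne_top hq₀'.ne hq₀ct
  have hq₀c1 : 1 < q₀' := (ENNReal.HolderConjugate.lt_top_iff_one_lt q₀ q₀').1 hq₀'
  have hYd := hYq.fourierBound hq₀c1 hq₀c.symm (by linarith [hq₀R.symm.lt])
    (by have := hq₀R.conjugate_eq
        rw [this, div_le_iff₀ (by linarith)]
        nlinarith) d
  obtain ⟨K, hK, hmain⟩ := exists_lintegral_multiplier_le hXd hYd
    (by simpa using hp₀R.inv_add_inv_eq_one) (by simpa using hq₀R.symm.inv_add_inv_eq_one)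
    h1p hpp₀ h1q₀ hq₀q hpqR.le hr0 hline
  refine ⟨K, hK.le, fun m hm hw => ?_⟩
  obtain ⟨hn, hfin⟩ := hw
  set W := (weakLpNorm (fun ξ => ‖m ξ‖) r volume).toReal with hW
  have hW0 : 0 ≤ W := ENNReal.toReal_nonneg
  have hweak : ∀ A : ℝ, W ≤ A → HasWeakBound (fun ξ => ‖m ξ‖) r.toReal A volume := fun A hA =>
    hasWeakBound_of_weakLpNorm_le hrt hr0 (hW0.trans hA)
      ((ENNReal.le_ofReal_iff_toReal_le hfin.ne (hW0.trans hA)).2 hA)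
  have hg : HasModerateGrowth m := hasModerateGrowth_of_hasWeakBound hn h1r hW0 (hweak W le_rfl)
  -- The weak norm of the symbol and the norm of `f` may vanish; both are enlarged by `ε`.
  have hest : ∀ f : 𝓢(EuclideanSpace ℝ (Fin d), X), ∀ ε : ℝ, 0 < ε →
      eLpNorm (𝓕⁻ fun ξ => m ξ (𝓕 (f : EuclideanSpace ℝ (Fin d) → X) ξ)) q volume ≤
        ENNReal.ofReal (K * ((W + ε) * (‖f.toLp p volume‖ + ε))) := by
    intro f ε hε
    have hM : 0 < ‖f.toLp p volume‖ + ε := by positivity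
    have hfM : ∫⁻ x, ‖f x‖ₑ ^ p.toReal ≤ ENNReal.ofReal ((‖f.toLp p volume‖ + ε) ^ p.toReal) := by
      have h1 : eLpNorm f p volume ≤ ENNReal.ofReal (‖f.toLp p volume‖ + ε) := by
        rw [← eLpNorm_congr_ae (f.coeFn_toLp p volume), ← Lp.enorm_def, ← ofReal_norm]
        exact ENNReal.ofReal_le_ofReal (by linarith)
      rw [eLpNorm_eq_lintegral_rpow_enorm_toReal hp0 hpt] at h1
      have h2 := ENNReal.rpow_le_rpow h1 (by linarith : 0 ≤ p.toReal)
      rwa [← ENNReal.rpow_mul, one_div_mul_cancel (by linarith), ENNReal.rpow_one,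
        ENNReal.ofReal_rpow_of_nonneg hM.le (by linarith)] at h2
    have h3 := lintegral_multiplier_le_of_truncation hm hn f.integrable
      (memLp_one_iff_integrable.1 (memLp_one_apply_schwartz hm hg (𝓕 f))) (q := q.toReal)
      (R := ENNReal.ofReal ((K * ((W + ε) * (‖f.toLp p volume‖ + ε))) ^ q.toReal)) fun N =>
        hmain _ (W + ε) (by positivity)
          (HasWeakBound.indicator (fun t ht => by
            simpa using hweak (W + ε) (by linarith) t ht) _)
          (fun g hgi => integrable_indicator_symbolTruncationSet hm hn N hgi) f
          f.continuous.stronglyMeasurable f.integrable _ hM hfM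
    rw [eLpNorm_eq_lintegral_rpow_enorm_toReal hq0 hq'.ne]
    refine (ENNReal.rpow_le_rpow h3 (by positivity)).trans (le_of_eq ?_)
    rw [ENNReal.ofReal_rpow_of_nonneg (by positivity) (by positivity),
      ← Real.rpow_mul (by positivity), mul_one_div_cancel (by linarith), Real.rpow_one]
  have hL : ∀ f : 𝓢(EuclideanSpace ℝ (Fin d), X),
      MemLp (𝓕⁻ fun ξ => m ξ (𝓕 (f : EuclideanSpace ℝ (Fin d) → X) ξ)) q volume := fun f =>
    ⟨(continuous_fourierInv (memLp_one_iff_integrable.1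
      (memLp_one_apply_schwartz hm hg (𝓕 f)))).aestronglyMeasurable,
      (hest f 1 one_pos).trans_lt ENNReal.ofReal_lt_top⟩
  refine ⟨hg, exists_unique_extendsMultiplierOp hpt hm hg (by positivity) hL fun f => ?_⟩
  have hlim : Filter.Tendsto (fun ε : ℝ => K * ((W + ε) * (‖f.toLp p volume‖ + ε)))
      (nhdsWithin 0 (Set.Ioi 0)) (nhds (K * W * ‖f.toLp p volume‖)) := by
    have h1 : Continuous fun ε : ℝ => K * ((W + ε) * (‖f.toLp p volume‖ + ε)) := by fun_prop
    have h2 := (h1.tendsto 0).mono_left (nhdsWithin_le_nhds (s := Set.Ioi 0))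
    simpa [mul_assoc] using h2
  refine ge_of_tendsto hlim ?_
  filter_upwards [self_mem_nhdsWithin] with ε hε
  have hε0 : 0 < ε := hε
  rw [Lp.norm_toLp]
  exact ENNReal.toReal_le_of_le_ofReal (by positivity) (hest f ε hε0)
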